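/- Let $f\in C^\infty(\mathbf R^3)$ be real-valued. For $(p,q)\in\mathbf R^2$ and $t>0$ let $f_{(p,q,t)}(\omega)=f((p,q,0)+t\omega)$, $\omega\in\mathbf S^2$, where $\omega=(\sin\theta\cos\varphi,\sin\theta\sin\varphi,\cos\theta)$ and $d\omega$ is the surface measure on $\mathbf S^2$. Put $$Mf(p,q,t)=\frac1{4\pi}\int_{\mathbf S^2}f_{(p,q,t)}\,d\omega,\qquad a_{0n}(p,q,t)=\frac{2n+1}{4\pi}\int_{\mathbf S^2}f_{(p,q,t)}\,P_n(\cos\theta)\,d\omega,$$ and, for $1\le m\le n$, $$a_{mn}(p,q,t)=\frac{2n+1}{2\pi}\frac{(n-m)!}{(n+m)!}\int_{\mathbf S^2}f_{(p,q,t)}\,P_{nm}(\cos\theta)\cos(m\varphi)\,d\omega,$$ $$b_{mn}(p,q,t)=\frac{2n+1}{2\pi}\frac{(n-m)!}{(n+m)!}\int_{\mathbf S^2}f_{(p,q,t)}\,P_{nm}(\cos\theta)\sin(m\varphi)\,d\omega,$$ where $P_n$ are the Legendre polynomials and $P_{nm}(x)=(1-x^2)^{m/2}\frac{d^m}{dx^m}P_n(x)$.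 Let $\Delta=\partial_p^2+\partial_q^2$. There is exactly one family of real numbers $c_m(2k,2i)$, $s_m(2k-1,2(i-1))$ with the following properties: $c_m(2k,2i)=0$ unless $0\le i\le k$ and $1\le m\le k+i$; $s_m(2k-1,2(i-1))=0$ unless $1\le i\le k$ and $1\le m\le k+i-1$; the initial values are $$c_1(2,0)=-15,\quad c_1(2,2)=-\tfrac{15}4,\quad c_2(2,2)=\tfrac{15}4,\quad s_1(1,0)=3;$$ and for all $k\ge1$ the following recursions hold. For $i=0$: $$c_m(2k+2,0)=(4k+5)\Big(\frac{c_m(2k,0)}{4k+1}-\frac{(4k+3)c_m(2k,0)}{(8k+2)(k-m+1)}\Big)\quad(1\le m\le k),$$ $$c_{k+1}(2k+2,0)=(4k+5)\Big(\sum_{m=1}^{k}\frac{(4k+3)c_m(2k,0)}{(8k+2)(k-m+1)}-(4k+3)\Big).$$ For $1\le i\le k+1$: $$c_m(2k+2,2i)=(4k+5)\Big(\frac{c_m(2k,2i)}{4k+1}-\frac{(4k+3)c_m(2k,2i)}{(8k+2)(k+i-m+1)}-\frac{s_m(2k+1,2(i-1))}{4(k+i-m+1)}\Big)\quad(1\le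 m\le k+i),$$ $$c_{k+i+1}(2k+2,2i)=(4k+5)\sum_{m=1}^{k+i}\Big(\frac{(4k+3)c_m(2k,2i)}{(8k+2)(k+i-m+1)}+\frac{s_m(2k+1,2(i-1))}{4(k+i-m+1)}\Big).$$ For $1\le i\le k+1$, with $$T_{i,m}=\frac{c_m(2k,2(i-1))}{k+i-m}-\frac{k(2k-1)(4k+1)s_m(2k-1,2(i-1))}{(4k-1)(k+i-m)}$$ and $\delta_{i1}=1$ if $i=1$, $\delta_{i1}=0$ otherwise: $$s_m(2k+1,2(i-1))=\frac{4k+3}{(2k+2)(2k+1)}\Big(\frac{2k(2k-1)s_m(2k-1,2(i-1))}{4k-1}+T_{i,m}\Big)\quad(1\le m\le k+i-1),$$ $$s_{k+i}(2k+1,2(i-1))=\frac{4k+3}{(2k+2)(2k+1)}\Big((8k+2)\,\delta_{i1}-\sum_{m=1}^{k+i-1}T_{i,m}\Big).$$ With these coefficients (which do not depend on $f$), for every such $f$, all integers $k>0$, all $(p,q)\in\mathbf R^2$ and all $t>0$, $$a_{0(2k)}(p,q,t)=(4k+1)\,Mf(p,q,t)+\int_0^t\sum_{i=0}^{k}t^{2i-1}\sum_{m=1}^{k+i}c_m(2k,2i)\Big(\frac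 ut\Big)^{2m}\Delta^iMf(p,q,u)\,du$$ and $$\partial_pa_{1(2k-1)}(p,q,t)+\partial_qb_{1(2k-1)}(p,q,t)=\int_0^t\sum_{i=1}^{k}t^{2(i-1)}\sum_{m=1}^{k+i-1}s_m(2k-1,2(i-1))\Big(\frac ut\Big)^{2m}\Delta^iMf(p,q,u)\,du;$$ here $Mf(\cdot,\cdot,u)$ is smooth for every $u$, the partial derivatives on the left exist, and the integrands are integrable on $[0,t]$. -/

import Mathlib

noncomputable section

namespace SphericalCoeffs

/-- Euclidean space `ℝ³`. -/
abbrev E3 := EuclideanSpace ℝ (Fin 3)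

/-- The unit sphere `S²` of `ℝ³`. -/
abbrev S2 := Metric.sphere (0 : E3) 1

/-- The surface measure `dω` on `S²` (of total mass `4π`). -/
def surf : MeasureTheory.Measure S2 :=
  (MeasureTheory.volume : MeasureTheory.Measure E3).toSphere

/-- The polar angle `θ ∈ [0, π]` of `ω`, measured from the `z`-axis. -/
def polarAngle (ω : S2) : ℝ := Real.arccos ((ω : E3) 2)

/-- The azimuth `φ ∈ (-π, π]` of `ω`:
`ω = (sin θ cos φ, sin θ sin φ, cos θ)` (and `φ = 0` at the two poles). -/
def azimuth (ω : S2) : ℝ := Complex.arg ⟨(ω : E3) 0, (ω : E3) 1⟩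

/-- The Legendre polynomial `P_n = (2ⁿ n!)⁻¹ dⁿ/dxⁿ (x² - 1)ⁿ`. -/
def legendre (n : ℕ) : Polynomial ℝ :=
  Polynomial.C (1 / (2 ^ n * (n.factorial : ℝ))) *
    Polynomial.derivative^[n] ((Polynomial.X ^ 2 - 1) ^ n)

/-- The function `P_{nm}(x) = (1 - x²)^{m/2} dᵐ/dxᵐ P_n(x)`, i.e. `(-1)ᵐ` times the associated
Legendre function `P_n^m` taken with the Condon–Shortley phase; so `P_{11}(cos θ) = sin θ`. -/
def assocLegendre (n m : ℕ) (x : ℝ) : ℝ :=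
  Real.sqrt (1 - x ^ 2) ^ m * (Polynomial.derivative^[m] (legendre n)).eval x

/-- The restriction `f_{(p,q,t)}` of `f` to the sphere of radius `t` centred at `(p, q, 0)`,
as a function of the direction `ω`. -/
def restr (f : E3 → ℝ) (p q t : ℝ) (ω : S2) : ℝ :=
  f (!₂[p, q, 0] + t • (ω : E3))

/-- The spherical mean `Mf(p, q, t)`. -/
def sphMean (f : E3 → ℝ) (p q t : ℝ) : ℝ :=
  1 / (4 * Real.pi) * ∫ ω, restr f p q t ω ∂surf

/-- The zonal coefficient `a_{0n}(p, q, t)`. -/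
def zonalCoeff (f : E3 → ℝ) (n : ℕ) (p q t : ℝ) : ℝ :=
  (2 * n + 1) / (4 * Real.pi) *
    ∫ ω, restr f p q t ω * (legendre n).eval (Real.cos (polarAngle ω)) ∂surf

/-- The coefficient `a_{mn}(p, q, t)`, for `1 ≤ m ≤ n`. -/
def cosCoeff (f : E3 → ℝ) (m n : ℕ) (p q t : ℝ) : ℝ :=
  (2 * n + 1) / (2 * Real.pi) * ((n - m).factorial / (n + m).factorial) *
    ∫ ω, restr f p q t ω * assocLegendre n m (Real.cos (polarAngle ω)) *
      Real.cos (m * azimuth ω) ∂surf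

/-- The coefficient `b_{mn}(p, q, t)`, for `1 ≤ m ≤ n`. -/
def sinCoeff (f : E3 → ℝ) (m n : ℕ) (p q t : ℝ) : ℝ :=
  (2 * n + 1) / (2 * Real.pi) * ((n - m).factorial / (n + m).factorial) *
    ∫ ω, restr f p q t ω * assocLegendre n m (Real.cos (polarAngle ω)) *
      Real.sin (m * azimuth ω) ∂surf

/-- The Laplace operator `∂²/∂p² + ∂²/∂q²` on functions of `(p, q)`. -/
def lap (g : ℝ → ℝ → ℝ) (p q : ℝ) : ℝ :=
  deriv (deriv fun x => g x q) p + deriv (deriv fun y => g p y) q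

/-- `Δⁱ Mf(p, q, u)`, the Laplacian acting in `(p, q)`. -/
def lapMean (f : E3 → ℝ) (i : ℕ) (p q u : ℝ) : ℝ :=
  (lap^[i] fun x y => sphMean f x y u) p q

/-- The recursions that determine the coefficients. In this definition
`c k i m` is `c_m(2k, 2i)` and `s k i m` is `s_m(2k - 1, 2(i - 1))`. -/
structure IsCoeffFamily (c s : ℕ → ℕ → ℕ → ℝ) : Prop where
  /-- `c_m(2k, 2i) = 0` unless `0 ≤ i ≤ k` and `1 ≤ m ≤ k + i`. -/
  c_zero : ∀ k i m : ℕ, ¬ (i ≤ k ∧ 1 ≤ m ∧ m ≤ k + i) → c k i m = 0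
  /-- `s_m(2k - 1, 2(i - 1)) = 0` unless `1 ≤ i ≤ k` and `1 ≤ m ≤ k + i - 1`. -/
  s_zero : ∀ k i m : ℕ, ¬ (1 ≤ i ∧ i ≤ k ∧ 1 ≤ m ∧ m < k + i) → s k i m = 0
  -- initial values: `c_1(2,0)`, `c_1(2,2)`, `c_2(2,2)`, `s_1(1,0)`
  c_init_0_1 : c 1 0 1 = -15
  c_init_1_1 : c 1 1 1 = -15 / 4
  c_init_1_2 : c 1 1 2 = 15 / 4
  s_init : s 1 1 1 = 3
  -- `c_m(2k+2, 0)`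
  c_rec_0 : ∀ k m : ℕ, 1 ≤ k → 1 ≤ m → m ≤ k →
    c (k + 1) 0 m = (4 * k + 5) * (c k 0 m / (4 * k + 1)
      - (4 * k + 3) * c k 0 m / ((8 * k + 2) * ((k : ℝ) - m + 1)))
  c_rec_0_last : ∀ k : ℕ, 1 ≤ k →
    c (k + 1) 0 (k + 1) = (4 * k + 5) *
      ((∑ m ∈ Finset.Icc 1 k, (4 * k + 3) * c k 0 m / ((8 * k + 2) * ((k : ℝ) - m + 1)))
        - (4 * k + 3))
  -- `c_m(2k+2, 2i)` with `1 ≤ i ≤ k + 1`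
  c_rec : ∀ k i m : ℕ, 1 ≤ k → 1 ≤ i → i ≤ k + 1 → 1 ≤ m → m ≤ k + i →
    c (k + 1) i m = (4 * k + 5) *
      (-((4 * k + 3) * c k i m / ((8 * k + 2) * ((k : ℝ) + i - m + 1)))
        - s (k + 1) i m / (4 * ((k : ℝ) + i - m + 1))
        + c k i m / (4 * k + 1))
  c_rec_last : ∀ k i : ℕ, 1 ≤ k → 1 ≤ i → i ≤ k + 1 →
    c (k + 1) i (k + i + 1) = (4 * k + 5) * ∑ m ∈ Finset.Icc 1 (k + i),
      ((4 * k + 3) * c k i m / ((8 * k + 2) * ((k : ℝ) + i - m + 1))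
        + s (k + 1) i m / (4 * ((k : ℝ) + i - m + 1)))
  -- `s_m(2k+1, 0)`
  s_rec_1 : ∀ k m : ℕ, 1 ≤ k → 1 ≤ m → m ≤ k →
    s (k + 1) 1 m = (4 * k + 3) / ((2 * k + 2) * (2 * k + 1)) *
      (2 * k * (2 * k - 1) * s k 1 m / (4 * k - 1)
        + c k 0 m / ((k : ℝ) + 1 - m)
        - k * (2 * k - 1) * (4 * k + 1) * s k 1 m / ((4 * k - 1) * ((k : ℝ) + 1 - m)))
  s_rec_1_last : ∀ k : ℕ, 1 ≤ k →
    s (k + 1) 1 (k + 1) = (4 * k + 3) / ((2 * k + 2) * (2 * k + 1)) *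
      (8 * k + 2 - ∑ m ∈ Finset.Icc 1 k,
        (c k 0 m / ((k : ℝ) + 1 - m)
          - k * (2 * k - 1) * (4 * k + 1) * s k 1 m / ((4 * k - 1) * ((k : ℝ) + 1 - m))))
  -- `s_m(2k+1, 2(i-1))` with `1 < i ≤ k + 1`
  s_rec : ∀ k i m : ℕ, 1 ≤ k → 1 < i → i ≤ k + 1 → 1 ≤ m → m < k + i →
    s (k + 1) i m = (4 * k + 3) / ((2 * k + 2) * (2 * k + 1)) *
      (2 * k * (2 * k - 1) * s k i m / (4 * k - 1)
        + c k (i - 1) m / ((k : ℝ) + i - m)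
        - k * (2 * k - 1) * (4 * k + 1) * s k i m / ((4 * k - 1) * ((k : ℝ) + i - m)))
  s_rec_last : ∀ k i : ℕ, 1 ≤ k → 1 < i → i ≤ k + 1 →
    s (k + 1) i (k + i) = -((4 * k + 3) / ((2 * k + 2) * (2 * k + 1))) *
      ∑ m ∈ Finset.Icc 1 (k + i - 1),
        (c k (i - 1) m / ((k : ℝ) + i - m)
          - k * (2 * k - 1) * (4 * k + 1) * s k i m / ((4 * k - 1) * ((k : ℝ) + i - m)))

/-- The integrand `∑_{i=0}^{k} t^{2i-1} ∑_{m=1}^{k+i} c_m(2k,2i) (u/t)^{2m} Δⁱ Mf(p,q,u)`. -/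
def zonalIntegrand (c : ℕ → ℕ → ℕ → ℝ) (f : E3 → ℝ) (k : ℕ) (p q t u : ℝ) : ℝ :=
  ∑ i ∈ Finset.Icc 0 k, t ^ (2 * (i : ℤ) - 1) *
    ∑ m ∈ Finset.Icc 1 (k + i), c k i m * (u / t) ^ (2 * m) * lapMean f i p q u

/-- The integrand
`∑_{i=1}^{k} t^{2(i-1)} ∑_{m=1}^{k+i-1} s_m(2k-1,2(i-1)) (u/t)^{2m} Δⁱ Mf(p,q,u)`. -/
def divIntegrand (s : ℕ → ℕ → ℕ → ℝ) (f : E3 → ℝ) (k : ℕ) (p q t u : ℝ) : ℝ :=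
  ∑ i ∈ Finset.Icc 1 k, t ^ (2 * (i - 1)) *
    ∑ m ∈ Finset.Icc 1 (k + i - 1), s k i m * (u / t) ^ (2 * m) * lapMean f i p q u

end SphericalCoeffs

end

noncomputable section

namespace SphericalCoeffs

open Polynomial

/-! ### Identities between Legendre polynomials and their derivatives. -/

section Legendre

/-! Write A_n = a_{0n} and D_n = ∂_p a_{1n} + ∂_q b_{1n}. As functions of the radius t they form a
ladder A_0, D_1, A_2, D_3, … tied together by first-order equations: `divCoeff_eq` expresses
D_{2k+1} through A_{2k}, A_{2k+2} and their t-derivatives, and `zonalCoeff_hlap_eq` expresses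
ΔA_{2k} through D_{2k-1}, D_{2k+1} and theirs. Both rest on the rotation invariance of the surface
measure, which yields a divergence theorem on the sphere (`integral_tangential_deriv`) and so trades
radial for horizontal derivatives; three-term Legendre identities do the rest.

Climbing one rung means solving h' + (α/t) h = g with α > 0. The homogeneous solution t^{-α} is
singular at 0, whereas A_n and D_n are smooth in t up to 0, so the solution is unique
(`eq_momentSum`) and it suffices to check a candidate. The candidate is a combination of terms
t^{2j+r-2m} ∫₀ᵗ u^{2m} N_j(u) du, where N_j is an iterated Laplacian of Mf. Its derivative splits
into terms of the same kind and boundary terms. Matching the former fixes every coefficient of a row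
except the top one (`c_relation`, `s_relation`); matching the latter fixes the top one
(`c_sum_relation`, `s_sum_relation`). Solved for the new coefficients, these are the stated
recursions.

Since ΔA_{2k} is A_{2k} formed with the horizontal Laplacian of f, the induction runs over all f
simultaneously. It starts at k = 0 with A_0 = Mf and with D_0 = 0 in the place of D_{-1}. -/

/-- The polynomial `(x² - 1)ⁿ`. -/
def legendreBase (n : ℕ) : ℝ[X] := (X ^ 2 - 1) ^ n

/-- A primitive of the Legendre polynomial, `(2ⁿ n!)⁻¹ dⁿ⁻¹/dxⁿ⁻¹ (x² - 1)ⁿ`. -/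
def legendrePrim (n : ℕ) : ℝ[X] :=
  C (1 / (2 ^ n * (n.factorial : ℝ))) * derivative^[n - 1] (legendreBase n)

lemma derivative_legendreBase_succ (n : ℕ) :
    derivative (legendreBase (n + 1)) = C (2 * (n + 1) : ℝ) * (X * legendreBase n) := by
  simp [legendreBase, derivative_pow]
  ring

/-- Writing x² as (x² - 1) + 1 in the second derivative leaves only powers of x² - 1; after n
further differentiations this becomes a three-term recursion. -/
lemma derivative_derivative_legendreBase (n : ℕ) :
    derivative (derivative (legendreBase (n + 2))) =
      C (2 * (n + 2) : ℝ) * (C (2 * n + 3 : ℝ) * legendreBase (n + 1)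
        + C (2 * (n + 1) : ℝ) * legendreBase n) := by
  rw [derivative_legendreBase_succ, derivative_C_mul, derivative_mul,
    derivative_legendreBase_succ]
  simp only [legendreBase, pow_succ, C_mul, map_natCast, C_1, C_ofNat, derivative_X,
    Nat.cast_add, Nat.cast_one, map_add]
  ring

lemma legendre_coeff_succ (n : ℕ) :
    1 / (2 ^ (n + 1) * ((n + 1).factorial : ℝ)) * (2 * (n + 1)) =
      1 / (2 ^ n * (n.factorial : ℝ)) := by
  rw [Nat.factorial_succ]
  have : (n.factorial : ℝ) ≠ 0 := by positivity
  push_cast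
  field_simp
  ring

lemma legendre_eq_C_mul (n : ℕ) :
    legendre n = C (1 / (2 ^ n * (n.factorial : ℝ))) * derivative^[n] (legendreBase n) := rfl

lemma derivative_legendrePrim (n : ℕ) : derivative (legendrePrim (n + 1)) = legendre (n + 1) := by
  rw [legendrePrim, legendre_eq_C_mul, derivative_C_mul, Nat.add_sub_cancel,
    Function.iterate_succ_apply']

/-- `P_{n+2} = (2n+3) R_{n+1} + P_n`, with `R` the primitive. -/
lemma legendre_add_two (n : ℕ) :
    legendre (n + 2) = C (2 * n + 3 : ℝ) * legendrePrim (n + 1) + legendre n := by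
  have h1 := legendre_coeff_succ (n + 1)
  have h0 := legendre_coeff_succ n
  rw [legendre_eq_C_mul, legendrePrim, legendre_eq_C_mul, Function.iterate_add_apply]
  have : derivative^[2] (legendreBase (n + 2)) =
      derivative (derivative (legendreBase (n + 2))) := rfl
  rw [this, derivative_derivative_legendreBase, iterate_derivative_C_mul,
    iterate_map_add, iterate_derivative_C_mul, iterate_derivative_C_mul,
    Nat.add_sub_cancel, ← mul_assoc, ← C_mul]
  rw [← h0, ← h1] 
  push_cast
  simp only [C_mul, C_add, map_natCast, C_1, C_ofNat]
  ring

/-- One differentiation of the base produces a factor x, and in the Leibniz rule for the remaining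
ones only x and its first derivative contribute. -/
lemma legendre_succ_eq (n : ℕ) :
    legendre (n + 2) = X * legendre (n + 1) + C (n + 1 : ℝ) * legendrePrim (n + 1) := by
  have h1 := legendre_coeff_succ (n + 1)
  rw [legendre_eq_C_mul, legendrePrim, legendre_eq_C_mul, Function.iterate_succ_apply,
    derivative_legendreBase_succ, iterate_derivative_C_mul, mul_comm X (legendreBase _),
    iterate_derivative_mul_X, ← h1]
  push_cast
  simp only [C_mul, C_add, nsmul_eq_mul]
  push_cast
  simp only [map_natCast, C_1]
  ring

lemma iterate_derivative_X_sq_sub_one_mul (n : ℕ) (g : ℝ[X]) :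
    derivative^[n + 2] ((X ^ 2 - 1) * g) = (X ^ 2 - 1) * derivative^[n + 2] g
      + C (2 * (n + 2) : ℝ) * X * derivative^[n + 1] g
      + C ((n + 2) * (n + 1) : ℝ) * derivative^[n] g := by
  have : (X ^ 2 - 1) * g = (g * X) * X - g := by ring
  rw [this, iterate_derivative_sub, iterate_derivative_mul_X, iterate_derivative_mul_X]
  simp only [nsmul_eq_mul, show n + 2 - 1 = n + 1 from rfl]
  rw [iterate_derivative_mul_X]
  simp only [Nat.add_sub_cancel, nsmul_eq_mul]
  push_cast
  simp only [C_mul, C_add, map_natCast, C_1, C_ofNat]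
  ring

/-- The Legendre differential equation in integrated form. -/
lemma X_sq_sub_one_mul_derivative_legendre (n : ℕ) :
    (X ^ 2 - 1) * derivative (legendre (n + 1)) =
      C ((n + 1) * (n + 2) : ℝ) * legendrePrim (n + 1) := by
  have h1 := legendre_coeff_succ (n + 1)
  -- A second expression for P_{n+2}, from the factorization (x² - 1)^{n+2} = (x² - 1)(x² -
  -- 1)^{n+1}; comparison with `legendre_succ_eq` cancels P_{n+2} and x P_{n+1}.
  have hP : C (2 * (n + 2) : ℝ) * legendre (n + 2) =
      (X ^ 2 - 1) * derivative (legendre (n + 1)) + C (2 * (n + 2) : ℝ) * X * legendre (n + 1)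
        + C ((n + 2) * (n + 1) : ℝ) * legendrePrim (n + 1) := by
    have hb : legendreBase (n + 2) = (X ^ 2 - 1) * legendreBase (n + 1) := by
      simp only [legendreBase]; ring
    rw [legendre_eq_C_mul, hb, iterate_derivative_X_sq_sub_one_mul, legendrePrim,
      legendre_eq_C_mul, derivative_C_mul, ← Function.iterate_succ_apply' derivative (n + 1), ← h1]
    push_cast
    simp only [C_mul, C_add, map_natCast, C_1, C_ofNat]
    ring
  have h2 := legendre_succ_eq n
  rw [h2] at hP
  simp only [C_mul, C_add, map_natCast, C_1, C_ofNat] at hP ⊢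
  linear_combination -hP

lemma legendre_zero : legendre 0 = 1 := by simp [legendre]

lemma legendre_one : legendre 1 = X := by
  simp [legendre]
  rw [show (1 + 1 : ℝ[X]) = C 2 by rw [C_ofNat]; norm_num, ← mul_assoc, ← C_mul]; norm_num

/-- `(2n+1) P_n = P_{n+1}' - P_{n-1}'`. -/
lemma legendre_eq_derivative_sub (n : ℕ) :
    C (2 * n + 1 : ℝ) * legendre n =
      derivative (legendre (n + 1)) - derivative (legendre (n - 1)) := by
  cases n with
  -- Here n - 1 truncates to 0, which is harmless because P_0' = 0.
  | zero => simp [legendre_zero, legendre_one]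
  | succ n =>
    rw [legendre_add_two, derivative_add, derivative_C_mul, derivative_legendrePrim]
    simp only [Nat.add_sub_cancel]
    push_cast
    simp only [C_mul, C_add, map_natCast, C_1, C_ofNat]
    ring

/-- Bonnet's recursion. -/
lemma legendre_bonnet (n : ℕ) :
    C (2 * n + 1 : ℝ) * (X * legendre n) =
      C (n + 1 : ℝ) * legendre (n + 1) + C (n : ℝ) * legendre (n - 1) := by
  cases n with
  | zero => simp [legendre_zero, legendre_one]
  | succ n =>
    have h1 := legendre_add_two n
    have h2 := legendre_succ_eq n
    simp only [Nat.add_sub_cancel]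
    push_cast
    simp only [C_mul, C_add, map_natCast, C_1, C_ofNat] at h1 h2 ⊢
    linear_combination (n + 1 : ℝ[X]) * h1 - (2 * n + 3 : ℝ[X]) * h2

/-- `(2n+1) x P_n' = n P_{n+1}' + (n+1) P_{n-1}'`. -/
lemma X_mul_derivative_legendre (n : ℕ) :
    C (2 * n + 1 : ℝ) * (X * derivative (legendre n)) =
      C (n : ℝ) * derivative (legendre (n + 1)) +
        C (n + 1 : ℝ) * derivative (legendre (n - 1)) := by
  have h1 := congrArg derivative (legendre_bonnet n)
  have h2 := legendre_eq_derivative_sub n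
  simp only [derivative_C, derivative_add, derivative_mul, derivative_X] at h1
  simp only [C_mul, C_add, map_natCast, C_1, C_ofNat] at h1 h2 ⊢
  linear_combination h1 - h2

/-- `(2n+1) (1-x²) P_n' = n(n+1) (P_{n-1} - P_{n+1})`. -/
lemma one_sub_X_sq_mul_derivative_legendre (n : ℕ) :
    C (2 * n + 1 : ℝ) * ((1 - X ^ 2) * derivative (legendre n)) =
      C (n * (n + 1) : ℝ) * (legendre (n - 1) - legendre (n + 1)) := by
  cases n with
  | zero => simp [legendre_zero]
  | succ n =>
    have h1 := legendre_add_two n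
    have h2 := X_sq_sub_one_mul_derivative_legendre n
    simp only [Nat.add_sub_cancel]
    push_cast
    simp only [C_mul, C_add, map_natCast, C_1, C_ofNat] at h1 h2 ⊢
    linear_combination -(2 * n + 3 : ℝ[X]) * h2 + (n + 1 : ℝ[X]) * (n + 2) * h1

/-- `(2n+1) ((1-x²) P_n' + x ((1-x²) P_n')') = -n(n+1) ((n-1) P_{n-1} + (n+2) P_{n+1})`. -/
lemma one_sub_X_sq_mul_derivative_legendre_add (n : ℕ) :
    C (2 * n + 1 : ℝ) * ((1 - 3 * X ^ 2) * derivative (legendre n) +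
        (1 - X ^ 2) * (X * derivative (derivative (legendre n)))) =
      -(C (n * (n + 1) : ℝ) *
        (C (n - 1 : ℝ) * legendre (n - 1) + C (n + 2 : ℝ) * legendre (n + 1))) := by
  have h1 := one_sub_X_sq_mul_derivative_legendre n
  have h2 := congrArg derivative h1
  have h3 := legendre_eq_derivative_sub n
  have h4 := legendre_bonnet n
  simp only [derivative_C, derivative_sub, derivative_mul, derivative_X_pow,
    derivative_one] at h2
  simp only [C_mul, C_add, C_sub, map_natCast, C_1, C_ofNat] at h1 h2 h3 h4 ⊢
  push_cast at h2
  linear_combination h1 + X * h2 + (n * (n + 1) : ℝ[X]) * (X * h3 - h4)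
 
end Legendre

end SphericalCoeffs

namespace SphericalCoeffs

/-! ### The coefficient family: existence, uniqueness, and the linear relations equivalent to the
recursions. -/

section Coefficients

open Finset

variable {c s : ℕ → ℕ → ℕ → ℝ}

/-- The correction term `T_{i,m}` in the recursion for `s_m(2k+1, 2(i-1))`. -/
def sCorr (k : ℕ) (c s : ℕ → ℕ → ℝ) (i m : ℕ) : ℝ :=
  c (i - 1) m / ((k : ℝ) + i - m) -
    k * (2 * k - 1) * (4 * k + 1) * s i m / ((4 * k - 1) * ((k : ℝ) + i - m))

/-- The correction term in the recursion for `c_m(2k+2, 2i)`. -/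
def cCorr (k : ℕ) (c s' : ℕ → ℕ → ℝ) (i m : ℕ) : ℝ :=
  (4 * k + 3) * c i m / ((8 * k + 2) * ((k : ℝ) + i - m + 1)) +
    s' i m / (4 * ((k : ℝ) + i - m + 1))

/-- The recursion step for the coefficients `s`. -/
def sStep (k : ℕ) (c s : ℕ → ℕ → ℝ) (i m : ℕ) : ℝ :=
  if 1 ≤ i ∧ i ≤ k + 1 ∧ 1 ≤ m ∧ m < k + 1 + i then
    if m < k + i then
      (4 * k + 3) / ((2 * k + 2) * (2 * k + 1)) *
        (2 * k * (2 * k - 1) * s i m / (4 * k - 1) + sCorr k c s i m)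
    else
      (4 * k + 3) / ((2 * k + 2) * (2 * k + 1)) *
        ((if i = 1 then (8 * k + 2 : ℝ) else 0) - ∑ m ∈ Icc 1 (k + i - 1), sCorr k c s i m)
  else 0

/-- The recursion step for the coefficients `c`. -/
def cStep (k : ℕ) (c s' : ℕ → ℕ → ℝ) (i m : ℕ) : ℝ :=
  if i ≤ k + 1 ∧ 1 ≤ m ∧ m ≤ k + 1 + i then
    if m ≤ k + i then (4 * k + 5) * (c i m / (4 * k + 1) - cCorr k c s' i m)
    else (4 * k + 5) * (∑ m ∈ Icc 1 (k + i), cCorr k c s' i m - if i = 0 then (4 * k + 3 : ℝ) else 0)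
  else 0

/-- The initial value is what the step yields at k = 0 from zero arrays, so the family obeys one
uniform recursion; the same holds for `c_succ`. Existence and uniqueness follow at once. -/
lemma IsCoeffFamily.s_succ (h : IsCoeffFamily c s) (k : ℕ) :
    s (k + 1) = sStep k (c k) (s k) := by
  ext i m
  unfold sStep
  split_ifs with h1 h2 h3
  · obtain ⟨hi, hk, hm, hm'⟩ := h1
    rcases Nat.eq_zero_or_pos k with rfl | hk0
    · omega
    rcases hi.eq_or_lt with rfl | hi'
    · rw [h.s_rec_1 k m hk0 hm (by omega), sCorr]
      push_cast
      ring
    · rw [h.s_rec k i m hk0 hi' hk hm h2, sCorr]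
      ring
  · obtain ⟨hi, hk, hm, hm'⟩ := h1
    obtain rfl : m = k + i := by omega
    subst h3
    rcases Nat.eq_zero_or_pos k with rfl | hk0
    · simp [h.s_init]
    rw [h.s_rec_1_last k hk0]
    simp [sCorr]
  · obtain ⟨hi, hk, hm, hm'⟩ := h1
    obtain rfl : m = k + i := by omega
    rcases Nat.eq_zero_or_pos k with rfl | hk0
    · omega
    rw [h.s_rec_last k i hk0 (by omega) hk, zero_sub, mul_neg, neg_mul]
    rfl
  · exact h.s_zero _ _ _ (by omega)

lemma IsCoeffFamily.c_succ (h : IsCoeffFamily c s) (k : ℕ) :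
    c (k + 1) = cStep k (c k) (s (k + 1)) := by
  have hc0 : ∀ i m, c 0 i m = 0 := fun i m => h.c_zero _ _ _ (by omega)
  have hs0 : ∀ k m, s k 0 m = 0 := fun i m => h.s_zero _ _ _ (by omega)
  ext i m
  unfold cStep
  split_ifs with h1 h2 h3
  · obtain ⟨hk, hm, hm'⟩ := h1
    rcases Nat.eq_zero_or_pos k with rfl | hk0
    · obtain rfl : i = 1 := by omega
      obtain rfl : m = 1 := by omega
      simp [h.c_init_1_1, cCorr, hc0, h.s_init]; norm_num
    rcases i.eq_zero_or_pos with rfl | hi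
    · rw [h.c_rec_0 k m hk0 hm (by omega), cCorr, hs0]
      push_cast
      ring
    · rw [h.c_rec k i m hk0 hi hk hm h2, cCorr]
      ring
  · obtain ⟨hk, hm, hm'⟩ := h1
    obtain rfl : m = k + i + 1 := by omega
    subst h3
    rcases Nat.eq_zero_or_pos k with rfl | hk0
    · simp [h.c_init_0_1]; norm_num
    rw [add_zero, h.c_rec_0_last k hk0]
    simp [cCorr, hs0]
  · obtain ⟨hk, hm, hm'⟩ := h1
    obtain rfl : m = k + i + 1 := by omega
    rcases Nat.eq_zero_or_pos k with rfl | hk0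
    · obtain rfl : i = 1 := by omega
      simp [h.c_init_1_2, cCorr, hc0, h.s_init]; norm_num
    rw [h.c_rec_last k i hk0 (by omega) hk]
    simp [cCorr]
  · exact h.c_zero _ _ _ (by omega)

/-- The coefficients, computed by recursion on `k`. -/
def coeffSeq : ℕ → (ℕ → ℕ → ℝ) × (ℕ → ℕ → ℝ)
  | 0 => (0, 0)
  | k + 1 => (cStep k (coeffSeq k).1 (sStep k (coeffSeq k).1 (coeffSeq k).2),
      sStep k (coeffSeq k).1 (coeffSeq k).2)

lemma IsCoeffFamily.eq_coeffSeq (h : IsCoeffFamily c s) (k : ℕ) : coeffSeq k = (c k, s k) := by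
  induction k with
  | zero =>
    refine Prod.ext ?_ ?_
    · ext i m; exact (h.c_zero _ _ _ (by omega)).symm
    · ext i m; exact (h.s_zero _ _ _ (by omega)).symm
  | succ k ih => rw [coeffSeq, ih, h.c_succ, h.s_succ]

lemma sStep_of_lt {k i m : ℕ} (c s : ℕ → ℕ → ℝ) (hi : 1 ≤ i) (hk : i ≤ k + 1) (hm : 1 ≤ m)
    (h : m < k + i) : sStep k c s i m = (4 * k + 3) / ((2 * k + 2) * (2 * k + 1)) *
        (2 * k * (2 * k - 1) * s i m / (4 * k - 1) + sCorr k c s i m) := by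
  rw [sStep, if_pos (by omega), if_pos h]

lemma sStep_last {k i : ℕ} (c s : ℕ → ℕ → ℝ) (hi : 1 ≤ i) (hk : i ≤ k + 1) :
    sStep k c s i (k + i) = (4 * k + 3) / ((2 * k + 2) * (2 * k + 1)) *
      ((if i = 1 then (8 * k + 2 : ℝ) else 0) - ∑ m ∈ Icc 1 (k + i - 1), sCorr k c s i m) := by
  rw [sStep, if_pos (by omega), if_neg (by omega)]

lemma cStep_of_le {k i m : ℕ} (c s' : ℕ → ℕ → ℝ) (hk : i ≤ k + 1) (hm : 1 ≤ m)
    (h : m ≤ k + i) :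
    cStep k c s' i m = (4 * k + 5) * (c i m / (4 * k + 1) - cCorr k c s' i m) := by
  rw [cStep, if_pos (by omega), if_pos h]

lemma cStep_last {k i : ℕ} (c s' : ℕ → ℕ → ℝ) (hk : i ≤ k + 1) :
    cStep k c s' i (k + i + 1) =
      (4 * k + 5) * (∑ m ∈ Icc 1 (k + i), cCorr k c s' i m - if i = 0 then (4 * k + 3 : ℝ) else 0) := by
  rw [cStep, if_pos (by omega), if_neg (by omega)]

lemma coeffSeq_fst_zero {k i m : ℕ} (h : ¬ (i ≤ k ∧ 1 ≤ m ∧ m ≤ k + i)) :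
    (coeffSeq k).1 i m = 0 := by
  cases k with
  | zero => rfl
  | succ k => exact if_neg (by omega)

lemma coeffSeq_snd_zero {k i m : ℕ} (h : ¬ (1 ≤ i ∧ i ≤ k ∧ 1 ≤ m ∧ m < k + i)) :
    (coeffSeq k).2 i m = 0 := by
  cases k with
  | zero => rfl
  | succ k => exact if_neg (by omega)

lemma coeffSeq_snd_succ (k : ℕ) :
    (coeffSeq (k + 1)).2 = sStep k (coeffSeq k).1 (coeffSeq k).2 := rfl

lemma coeffSeq_fst_succ (k : ℕ) :
    (coeffSeq (k + 1)).1 = cStep k (coeffSeq k).1 (coeffSeq (k + 1)).2 := rfl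

lemma coeffSeq_init_s : (coeffSeq 1).2 1 1 = 3 := by
  rw [coeffSeq_snd_succ]
  refine (sStep_last (k := 0) (i := 1) _ _ le_rfl le_rfl).trans ?_
  norm_num

lemma isCoeffFamily_coeffSeq :
    IsCoeffFamily (fun k => (coeffSeq k).1) (fun k => (coeffSeq k).2) where
  c_zero k i m h := coeffSeq_fst_zero h
  s_zero k i m h := coeffSeq_snd_zero h
  c_init_0_1 := by
    rw [coeffSeq_fst_succ]
    refine (cStep_last (k := 0) (i := 0) _ _ (by omega)).trans ?_
    norm_num
  c_init_1_1 := by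
    rw [coeffSeq_fst_succ, cStep_of_le _ _ le_rfl le_rfl le_rfl, cCorr, coeffSeq_init_s]
    norm_num [coeffSeq]
  c_init_1_2 := by
    rw [coeffSeq_fst_succ]
    refine (cStep_last (k := 0) (i := 1) _ _ (by omega)).trans ?_
    rw [show Icc 1 (0 + 1) = {1} from rfl, sum_singleton, cCorr, coeffSeq_init_s]
    norm_num [coeffSeq]
  s_init := coeffSeq_init_s
  c_rec_0 k m hk hm hmk := by
    rw [coeffSeq_fst_succ, cStep_of_le _ _ (by omega) hm (by omega), cCorr,
      coeffSeq_snd_zero (by omega)]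
    push_cast
    ring
  c_rec_0_last k hk := by
    rw [coeffSeq_fst_succ]
    refine (cStep_last (k := k) (i := 0) _ _ (by omega)).trans ?_
    have h0 : ∀ m, (coeffSeq (k + 1)).2 0 m = 0 := fun m => coeffSeq_snd_zero (by omega)
    simp [cCorr, h0]
  c_rec k i m hk hi hik hm hmk := by
    rw [coeffSeq_fst_succ, cStep_of_le _ _ hik hm hmk, cCorr]
    ring
  c_rec_last k i hk hi hik := by
    rw [coeffSeq_fst_succ, cStep_last _ _ hik, if_neg (by omega), sub_zero]
    rfl
  s_rec_1 k m hk hm hmk := by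
    rw [coeffSeq_snd_succ, sStep_of_lt _ _ le_rfl (by omega) hm (by omega), sCorr]
    push_cast
    ring
  s_rec_1_last k hk := by
    rw [coeffSeq_snd_succ, sStep_last _ _ le_rfl (by omega)]
    simp [sCorr]
  s_rec k i m hk hi hik hm hmk := by
    rw [coeffSeq_snd_succ, sStep_of_lt _ _ (by omega) hik hm hmk, sCorr]
    ring
  s_rec_last k i hk hi hik := by
    rw [coeffSeq_snd_succ, sStep_last _ _ (by omega) hik, if_neg (by omega), zero_sub, mul_neg, neg_mul]
    rfl

theorem existsUnique_isCoeffFamily :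
    ∃! cs : (ℕ → ℕ → ℕ → ℝ) × (ℕ → ℕ → ℕ → ℝ), IsCoeffFamily cs.1 cs.2 := by
  refine ⟨(fun k => (coeffSeq k).1, fun k => (coeffSeq k).2), isCoeffFamily_coeffSeq, ?_⟩
  rintro ⟨c, s⟩ h
  refine Prod.ext ?_ ?_
  · ext1 k; exact (congrArg Prod.fst (h.eq_coeffSeq k)).symm
  · ext1 k; exact (congrArg Prod.snd (h.eq_coeffSeq k)).symm

/-- The relation between coefficients that expresses the differential equation for `a_{0(2k+2)}`. -/
lemma IsCoeffFamily.c_relation (h : IsCoeffFamily c s) {k i m : ℕ} (hi : i ≤ k + 1)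
    (hm : 1 ≤ m) (hmk : m ≤ k + i + 1) :
    s (k + 1) i m = 2 * ((2 * i - 1 - 2 * m - 2 * k) * (c k i m / (4 * k + 1)) -
      2 * (k + i + 1 - m) * (c (k + 1) i m / (4 * k + 5))) := by
  rcases hmk.eq_or_lt with rfl | hlt
  -- At the top index the factor k + i + 1 - m vanishes, so the relation puts no condition on the
  -- top coefficient; `c_sum_relation` determines it.
  · rw [h.s_zero _ _ _ (by omega), h.c_zero k i _ (by omega)]
    push_cast
    ring
  · rw [h.c_succ, cStep_of_le _ _ hi hm (by omega), cCorr]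
    have h1 : (k : ℝ) + i - m + 1 ≠ 0 := by
      have : (m : ℝ) ≤ k + i := by exact_mod_cast Nat.lt_succ_iff.1 hlt
      linarith
    have h2 : (4 * k + 1 : ℝ) ≠ 0 := by positivity
    have h3 : (8 * k + 2 : ℝ) ≠ 0 := by positivity
    have h4 : (4 * k + 5 : ℝ) ≠ 0 := by positivity
    field_simp
    ring

/-- The corrections subtracted at m ≤ k + i are all added back in the top coefficient, so only the
inhomogeneous constant survives. This is the balance of boundary terms in the equation for A_{2k+2}.
-/
lemma IsCoeffFamily.c_sum_relation (h : IsCoeffFamily c s) {k i : ℕ} (hi : i ≤ k + 1) :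
    ∑ m ∈ Icc 1 (k + i + 1), c k i m / (4 * k + 1) -
      ∑ m ∈ Icc 1 (k + i + 1), c (k + 1) i m / (4 * k + 5) = if i = 0 then (4 * k + 3 : ℝ) else 0 := by
  rw [sum_Icc_succ_top (by omega), sum_Icc_succ_top (by omega), h.c_zero k i _ (by omega),
    h.c_succ, cStep_last _ _ hi]
  have h4 : (4 * k + 5 : ℝ) ≠ 0 := by positivity
  have : ∑ m ∈ Icc 1 (k + i), cStep k (c k) (s (k + 1)) i m / (4 * k + 5) =
      ∑ m ∈ Icc 1 (k + i), (c k i m / (4 * k + 1) - cCorr k (c k) (s (k + 1)) i m) := by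
    refine sum_congr rfl fun m hm => ?_
    rw [mem_Icc] at hm
    rw [cStep_of_le _ _ hi hm.1 hm.2]
    field_simp
  rw [this, sum_sub_distrib]
  field_simp
  ring

/-- The relation between coefficients that expresses the differential equation for
`∂_p a_{1(2k+1)} + ∂_q b_{1(2k+1)}`. -/
lemma IsCoeffFamily.s_relation (h : IsCoeffFamily c s) {k i m : ℕ} (hi : i ≤ k)
    (hm : 1 ≤ m) (hmk : m ≤ k + i + 1) :
    2 * (k + i + 1 - m) * ((2 * k + 2) * (2 * k + 1) / (4 * k + 3) * s (k + 1) (i + 1) m) =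
      (2 * i + 1 - 2 * m - 2 * k) * (2 * k * (2 * k - 1) / (4 * k - 1) * s k (i + 1) m) +
        2 * c k i m := by
  rcases hmk.eq_or_lt with rfl | hlt
  · rw [h.s_zero k _ _ (by omega), h.c_zero k i _ (by omega)]
    push_cast
    ring
  · rw [h.s_succ, sStep_of_lt _ _ (by omega) (by omega) hm (by omega), sCorr]
    have h1 : (k : ℝ) + (i + 1) - m ≠ 0 := by
      have : (m : ℝ) ≤ k + i := by exact_mod_cast Nat.lt_succ_iff.1 hlt
      linarith
    have h2 : (4 * k - 1 : ℝ) ≠ 0 := by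
      rcases k.eq_zero_or_pos with rfl | hk
      · norm_num
      · have : (1 : ℝ) ≤ k := by exact_mod_cast hk
        linarith
    have h3 : (4 * k + 3 : ℝ) ≠ 0 := by positivity
    push_cast
    field_simp
    ring

lemma IsCoeffFamily.s_sum_relation (h : IsCoeffFamily c s) {k i : ℕ} (hi : i ≤ k) :
    ∑ m ∈ Icc 1 (k + i + 1), (2 * k + 2) * (2 * k + 1) / (4 * k + 3) * s (k + 1) (i + 1) m -
      ∑ m ∈ Icc 1 (k + i + 1), 2 * k * (2 * k - 1) / (4 * k - 1) * s k (i + 1) m =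
        if i = 0 then (8 * k + 2 : ℝ) else 0 := by
  rw [sum_Icc_succ_top (by omega), sum_Icc_succ_top (by omega), h.s_zero k _ _ (by omega),
    h.s_succ, add_assoc k i 1, sStep_last _ _ (by omega) (by omega)]
  have : ∑ m ∈ Icc 1 (k + i),
      (2 * k + 2) * (2 * k + 1) / (4 * k + 3) * sStep k (c k) (s k) (i + 1) m =
      ∑ m ∈ Icc 1 (k + i), (2 * k * (2 * k - 1) / (4 * k - 1) * s k (i + 1) m +
        sCorr k (c k) (s k) (i + 1) m) := by
    refine sum_congr rfl fun m hm => ?_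
    rw [mem_Icc] at hm
    rw [sStep_of_lt _ _ (by omega) (by omega) hm.1 (by omega)]
    field_simp
  rw [this, sum_add_distrib]
  simp only [Nat.add_eq_right, show k + (i + 1) - 1 = k + i by omega]
  field_simp
  ring

end Coefficients

end SphericalCoeffs

namespace SphericalCoeffs

open MeasureTheory Metric
open scoped ContDiff Pointwise

/-! ### Differentiation under the integral over the sphere, and rotation invariance. -/

section SphereIntegral

instance : IsFiniteMeasure surf := by unfold surf; infer_instance

lemma integrable_surf {W : Type*} [NormedAddCommGroup W] {Φ : S2 → W} (h : Continuous Φ) :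
    Integrable Φ surf :=
  h.integrable_of_hasCompactSupport (HasCompactSupport.of_compactSpace Φ)

lemma continuous_sphere_slice {V W : Type*} [TopologicalSpace V] [TopologicalSpace W]
    {H : V × E3 → W} (h : Continuous H) (v : V) : Continuous fun y : S2 => H (v, y) := by
  fun_prop

/-- The derivative in the first variable of a function on `V × ℝ³`. -/
def fderivFst {V W : Type*} [NormedAddCommGroup V] [NormedSpace ℝ V] [NormedAddCommGroup W]
    [NormedSpace ℝ W] (H : V × E3 → W) (z : V × E3) : V →L[ℝ] W :=
  (fderiv ℝ H z).comp (ContinuousLinearMap.inl ℝ V E3)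

variable {V : Type} [NormedAddCommGroup V] [NormedSpace ℝ V]

lemma contDiff_fderivFst {W : Type*} [NormedAddCommGroup W] [NormedSpace ℝ W]
    {H : V × E3 → W} (h : ContDiff ℝ ∞ H) : ContDiff ℝ ∞ (fderivFst H) :=
  (h.fderiv_right (m := ∞) (by simp)).clm_comp contDiff_const

lemma hasFDerivAt_fderivFst {W : Type*} [NormedAddCommGroup W] [NormedSpace ℝ W]
    {H : V × E3 → W} (h : ContDiff ℝ ∞ H) (v : V) (x : E3) :
    HasFDerivAt (fun v => H (v, x)) (fderivFst H (v, x)) v :=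
  ((h.differentiable (by simp)) (v, x)).hasFDerivAt.comp v (hasFDerivAt_prodMk_left v x)

variable [FiniteDimensional ℝ V]

/-- Closed balls of V and the sphere are compact, so the derivative of the integrand is bounded
locally uniformly and a constant dominates it. -/
lemma hasFDerivAt_sphere_integral {W : Type*} [NormedAddCommGroup W] [NormedSpace ℝ W]
    {H : V × E3 → W} (h : ContDiff ℝ ∞ H) (v : V) :
    HasFDerivAt (fun v => ∫ y : S2, H (v, y) ∂surf) (∫ y : S2, fderivFst H (v, y) ∂surf) v := by
  have hD := (contDiff_fderivFst h).continuous
  have hK : IsCompact (closedBall v 1 ×ˢ (Set.univ : Set S2)) :=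
    (have : ProperSpace V := FiniteDimensional.proper_real V
    (isCompact_closedBall v 1)).prod isCompact_univ
  obtain ⟨B, hB⟩ := hK.exists_bound_of_continuousOn
    (f := fun z : V × S2 => fderivFst H (z.1, z.2)) (by fun_prop)
  refine hasFDerivAt_integral_of_dominated_of_fderiv_le (bound := fun _ => B)
    (F := fun v (y : S2) => H (v, y))
    (F' := fun v (y : S2) => fderivFst H (v, y)) (closedBall_mem_nhds v one_pos)
    (.of_forall fun v => (continuous_sphere_slice h.continuous v).aestronglyMeasurable)
    (integrable_surf (continuous_sphere_slice h.continuous v))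
    (continuous_sphere_slice hD v).aestronglyMeasurable
    (.of_forall fun y v' hv' => hB (v', y) ⟨hv', trivial⟩) (integrable_const _)
    (.of_forall fun y v' _ => hasFDerivAt_fderivFst h v' y)

lemma contDiff_sphere_integral {W : Type} [NormedAddCommGroup W] [NormedSpace ℝ W]
    {H : V × E3 → W} (h : ContDiff ℝ ∞ H) :
    ContDiff ℝ ∞ fun v => ∫ y : S2, H (v, y) ∂surf := by
  rw [contDiff_infty]
  intro n
  -- The derivative of the integral is again such an integral, with values in V →L[ℝ] W; hence the
  -- target must vary in the induction.
  induction n generalizing W with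
  | zero =>
    exact contDiff_zero.2 (continuous_iff_continuousAt.2 fun v =>
      (hasFDerivAt_sphere_integral h v).continuousAt)
  | succ n ih =>
    have hf : fderiv ℝ (fun v => ∫ y : S2, H (v, y) ∂surf) =
        fun v => ∫ y : S2, fderivFst H (v, y) ∂surf :=
      funext fun v => (hasFDerivAt_sphere_integral h v).fderiv
    push_cast
    refine contDiff_succ_iff_fderiv.2
      ⟨fun v => (hasFDerivAt_sphere_integral h v).differentiableAt, by simp, ?_⟩
    rw [hf]
    exact ih (contDiff_fderivFst h)

lemma hasDerivAt_sphere_integral {H : ℝ × E3 → ℝ} (h : ContDiff ℝ ∞ H) {s : ℝ} {H' : E3 → ℝ}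
    (hH' : ∀ x, HasDerivAt (fun s => H (s, x)) (H' x) s) :
    HasDerivAt (fun s => ∫ y : S2, H (s, y) ∂surf) (∫ y : S2, H' y ∂surf) s := by
  have h1 := (hasFDerivAt_sphere_integral h s).hasDerivAt
  have h2 : ∀ x, fderivFst H (s, x) 1 = H' x := fun x =>
    ((hasFDerivAt_fderivFst h s x).hasDerivAt).unique (hH' x)
  rw [ContinuousLinearMap.integral_apply
    (integrable_surf (continuous_sphere_slice (contDiff_fderivFst h).continuous s))] at h1
  simpa only [h2] using h1

/-- The surface measure is invariant under linear isometries. -/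
lemma integral_surf_comp_isometry (U : E3 ≃ₗᵢ[ℝ] E3) (Φ : E3 → ℝ) :
    ∫ y : S2, Φ (U y) ∂surf = ∫ y : S2, Φ y ∂surf := by
  let u : S2 → S2 := fun y => ⟨U y, by simp⟩
  let e : S2 ≃ₜ S2 :=
    { toFun := u
      invFun := fun y => ⟨U.symm y, by simp⟩
      left_inv := fun y => by simp [u]
      right_inv := fun y => by simp [u]
      continuous_toFun := by fun_prop
      continuous_invFun := by fun_prop }
  have hmp : MeasurePreserving e surf surf := by
    refine ⟨e.continuous.measurable, ?_⟩
    ext s hs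
    rw [Measure.map_apply e.continuous.measurable hs, surf,
      Measure.toSphere_apply' _ (e.continuous.measurable hs), Measure.toSphere_apply' _ hs]
    congr 1
    -- The surface measure of a set is a multiple of the volume of the cone over it, so invariance
    -- reduces to that of Lebesgue measure once cones are seen to correspond.
    have : Set.Ioo (0 : ℝ) 1 • ((↑) '' (e ⁻¹' s) : Set E3) =
        U ⁻¹' (Set.Ioo (0 : ℝ) 1 • ((↑) '' s : Set E3)) := by
      ext x
      simp only [Set.mem_smul, Set.mem_image, Set.mem_preimage]
      constructor
      · rintro ⟨r, hr, _, ⟨y, hy, rfl⟩, rfl⟩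
        exact ⟨r, hr, _, ⟨e y, hy, rfl⟩, by simp [e, u]⟩
      · rintro ⟨r, hr, _, ⟨y, hy, rfl⟩, hx⟩
        refine ⟨r, hr, _, ⟨e.symm y, by simpa using hy, rfl⟩, U.injective ?_⟩
        rw [map_smul, ← hx]
        simp [e]
    rw [this]
    exact U.measurePreserving.measure_preimage_equiv (f := U.toMeasurableEquiv) _
  exact hmp.integral_comp e.measurableEmbedding (fun y : S2 => Φ y)

/-- The standard basis vectors of `ℝ³`. -/
def basisVec (j : Fin 3) : E3 := EuclideanSpace.single j 1

/-- The rotation by the angle `s` in the plane of the `i`-th and the `j`-th coordinate. -/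
def rot (i j : Fin 3) (s : ℝ) : E3 →ₗ[ℝ] E3 where
  toFun x := x + ((Real.cos s - 1) * x i - Real.sin s * x j) • basisVec i +
    (Real.sin s * x i + (Real.cos s - 1) * x j) • basisVec j
  map_add' x y := by
    simp only [PiLp.add_apply]
    module
  map_smul' r x := by
    simp only [PiLp.smul_apply, smul_eq_mul, RingHom.id_apply]
    module

lemma rot_apply (i j : Fin 3) (s : ℝ) (x : E3) :
    rot i j s x = x + ((Real.cos s - 1) * x i - Real.sin s * x j) • basisVec i +
      (Real.sin s * x i + (Real.cos s - 1) * x j) • basisVec j := rfl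

lemma norm_rot {i j : Fin 3} (hij : i ≠ j) (s : ℝ) (x : E3) : ‖rot i j s x‖ = ‖x‖ := by
  have := Real.sin_sq_add_cos_sq s
  rw [EuclideanSpace.norm_eq, EuclideanSpace.norm_eq]
  congr 1
  simp only [Fin.sum_univ_three, Real.norm_eq_abs, sq_abs]
  -- The squared norm changes by (sin² + cos² - 1)(x_i² + x_j²); naming the second factor lets one
  -- certificate serve all six index pairs.
  obtain ⟨a, ha⟩ : ∃ a, a = x i ^ 2 + x j ^ 2 := ⟨_, rfl⟩
  fin_cases i <;> fin_cases j <;>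
    first
    | exact absurd rfl hij
    | (simp [rot_apply, basisVec] at ha ⊢; linear_combination a * this + (Real.sin s ^ 2 + Real.cos s ^ 2 - 1) * (-ha))

/-- The integrand is the derivative at s = 0 of Φ along a rotation, and the integral of the rotated
Φ does not depend on s. -/
lemma integral_rot_generator {i j : Fin 3} (hij : i ≠ j) {Φ : E3 → ℝ} (h : ContDiff ℝ ∞ Φ) :
    ∫ y : S2, ((y : E3) i * fderiv ℝ Φ y (basisVec j) - (y : E3) j * fderiv ℝ Φ y (basisVec i)) ∂surf = 0 := by
  have hr : ContDiff ℝ ∞ fun z : ℝ × E3 => rot i j z.1 z.2 := by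
    simp only [rot_apply]
    fun_prop
  have hd (x : E3) : HasDerivAt (fun s => Φ (rot i j s x))
      (x i * fderiv ℝ Φ x (basisVec j) - x j * fderiv ℝ Φ x (basisVec i)) 0 := by
    have h1 : HasDerivAt (fun s => rot i j s x) (x i • basisVec j - x j • basisVec i) 0 := by
      simp only [rot_apply]
      have hc := Real.hasDerivAt_cos 0
      have hs := Real.hasDerivAt_sin 0
      have := ((((hc.sub_const 1).mul_const (x i)).sub (hs.mul_const (x j))).smul_const
        (basisVec i)).const_add x |>.add (((hs.mul_const (x i)).add
          ((hc.sub_const 1).mul_const (x j))).smul_const (basisVec j))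
      refine this.congr_deriv ?_
      simp
      module
    have h0 : rot i j 0 x = x := by simp [rot_apply]
    have h2 : HasFDerivAt Φ (fderiv ℝ Φ x) (rot i j 0 x) := by
      rw [h0]
      exact ((h.differentiable (by simp)) x).hasFDerivAt
    exact (h2.comp_hasDerivAt 0 h1).congr_deriv (by simp)
  have h1 := hasDerivAt_sphere_integral (H := fun z => Φ (rot i j z.1 z.2)) (h.comp hr) hd
  refine h1.unique ?_
  have : (fun s => ∫ y : S2, Φ (rot i j s y) ∂surf) = fun _ => ∫ y : S2, Φ y ∂surf := by
    ext s
    exact integral_surf_comp_isometry (LinearIsometry.toLinearIsometryEquiv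
      ⟨rot i j s, norm_rot hij s⟩ rfl) Φ
  simp only [this]
  exact hasDerivAt_const _ _

end SphereIntegral

end SphericalCoeffs

namespace SphericalCoeffs

open MeasureTheory Metric Polynomial
open scoped ContDiff

/-! ### Divergence theorem on the sphere, and radial derivatives of weighted integrals. -/

section Divergence

/-- The partial derivative `∂F/∂x_j` of a function on `ℝ³`. -/
def pd (j : Fin 3) (F : E3 → ℝ) (x : E3) : ℝ := fderiv ℝ F x (basisVec j)

lemma contDiff_pd {F : E3 → ℝ} (h : ContDiff ℝ ∞ F) (j : Fin 3) : ContDiff ℝ ∞ (pd j F) :=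
  (h.fderiv_right (m := ∞) (by simp)).clm_apply contDiff_const

lemma pd_mul {F G : E3 → ℝ} (hF : ContDiff ℝ ∞ F) (hG : ContDiff ℝ ∞ G) (j : Fin 3) (x : E3) :
    pd j (fun x => F x * G x) x = F x * pd j G x + pd j F x * G x := by
  have h1 := (hF.differentiable (by simp)) x
  have h2 := (hG.differentiable (by simp)) x
  simp only [pd]
  rw [fderiv_fun_mul h1 h2]
  simp [mul_comm]

lemma pd_coord (i j : Fin 3) (x : E3) : pd j (fun x : E3 => x i) x = if i = j then 1 else 0 := by
  have : HasFDerivAt (fun x : E3 => x i) (EuclideanSpace.proj i : E3 →L[ℝ] ℝ) x :=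
    (EuclideanSpace.proj i : E3 →L[ℝ] ℝ).hasFDerivAt
  rw [pd, this.fderiv]
  simp [basisVec]

lemma pd_eval (Q : ℝ[X]) (j : Fin 3) (x : E3) :
    pd j (fun x : E3 => Q.eval (x 2)) x = if j = 2 then (derivative Q).eval (x 2) else 0 := by
  have h1 : HasFDerivAt (fun x : E3 => x 2) (EuclideanSpace.proj 2 : E3 →L[ℝ] ℝ) x :=
    (EuclideanSpace.proj 2 : E3 →L[ℝ] ℝ).hasFDerivAt
  have h2 := (Q.hasDerivAt (x 2)).comp_hasFDerivAt x h1
  rw [pd, show (fun x : E3 => Q.eval (x 2)) = (fun x => Q.eval x) ∘ fun x : E3 => x 2 from rfl,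
    h2.fderiv]
  simp [basisVec, eq_comm]

lemma pd_scale {F : E3 → ℝ} (hF : ContDiff ℝ ∞ F) (P : E3) (t : ℝ) (j : Fin 3) (x : E3) :
    pd j (fun x => F (P + t • x)) x = t * pd j F (P + t • x) := by
  have h1 : HasFDerivAt (fun x : E3 => P + t • x) (t • ContinuousLinearMap.id ℝ E3) x :=
    ((hasFDerivAt_id x).const_smul t).const_add P
  have h2 := ((hF.differentiable (by simp)) (P + t • x)).hasFDerivAt.comp x h1
  rw [pd, show (fun x => F (P + t • x)) = F ∘ fun x => P + t • x from rfl, h2.fderiv]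
  simp [pd]

lemma contDiff_coord (j : Fin 3) : ContDiff ℝ ∞ fun x : E3 => x j := by fun_prop

lemma contDiff_eval_coord (Q : ℝ[X]) : ContDiff ℝ ∞ fun x : E3 => Q.eval (x 2) :=
  by
  have h := (Q.contDiff_aeval (𝕜 := ℝ) ∞).comp (contDiff_coord 2)
  simp only [coe_aeval_eq_eval] at h
  exact h

lemma fderiv_self_eq_sum (F : E3 → ℝ) (x y : E3) :
    fderiv ℝ F x y = ∑ i, y i * pd i F x := by
  have : y = ∑ i, y i • basisVec i := by
    ext i
    simp [basisVec, Pi.single_apply]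
  conv_lhs => rw [this]
  simp [pd, map_sum]

lemma sum_sq_coord (y : S2) : ∑ i, (y : E3) i ^ 2 = 1 := by
  have := y.2
  rw [mem_sphere_zero_iff_norm, EuclideanSpace.norm_eq, Real.sqrt_eq_one] at this
  simpa using this

/-- The divergence theorem on the sphere for the tangential part of a coordinate field. -/
lemma integral_tangential_deriv {Φ : E3 → ℝ} (h : ContDiff ℝ ∞ Φ) (j : Fin 3) :
    ∫ y : S2, (pd j Φ y - (y : E3) j * ∑ i, (y : E3) i * pd i Φ y - 2 * ((y : E3) j * Φ y)) ∂surf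
      = 0 := by
  have hpd : ∀ i, Continuous (pd i Φ) := fun i => (contDiff_pd h i).continuous
  have hc := h.continuous
  -- The tangential part of e_j at y is ∑_i y_i (y_i e_j - y_j e_i), a combination of rotation
  -- fields. Applying the (i, j) rotation to y_i Φ costs an extra y_j Φ for each of the two i ≠ j,
  -- whence the factor 2.
  have hi (i : Fin 3) : ∫ y : S2, (((y : E3) i ^ 2 * pd j Φ y - (y : E3) j * ((y : E3) i * pd i Φ y))
      - if i = j then 0 else (y : E3) j * Φ y) ∂surf = 0 := by
    by_cases hij : i = j
    · subst hij
      simp [sq, mul_assoc]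
    · rw [← integral_rot_generator hij ((contDiff_coord i).mul h)]
      congr 1
      ext y
      change _ = (y : E3) i * pd j (fun x : E3 => x i * Φ x) y -
        (y : E3) j * pd i (fun x : E3 => x i * Φ x) y
      rw [pd_mul (contDiff_coord i) h, pd_mul (contDiff_coord i) h, pd_coord, pd_coord]
      simp only [hij, if_false, if_true]
      ring
  have hsum : ∑ i, ∫ y : S2, (((y : E3) i ^ 2 * pd j Φ y -
      (y : E3) j * ((y : E3) i * pd i Φ y)) - if i = j then 0 else (y : E3) j * Φ y) ∂surf = 0 :=
    Finset.sum_eq_zero fun i _ => hi i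
  rw [← integral_finsetSum] at hsum
  · rw [← hsum]
    congr 1
    ext y
    have h1 := sum_sq_coord y
    rw [Finset.sum_sub_distrib, Finset.sum_sub_distrib, ← Finset.sum_mul, h1, Finset.mul_sum]
    congr 1
    · ring
    · fin_cases j <;> simp [Fin.sum_univ_three] <;> ring
  · intro i _
    have := hpd i
    have := hpd j
    refine integrable_surf ?_
    split_ifs <;> fun_prop

/-- Differentiation in the radius of an integral against `y_j G`, in terms of `∂F/∂x_j`. -/
lemma hasDerivAt_integral_coord_mul {F G : E3 → ℝ} (hF : ContDiff ℝ ∞ F) (hG : ContDiff ℝ ∞ G)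
    (j : Fin 3) (P : E3) {t : ℝ} (ht : t ≠ 0) :
    HasDerivAt (fun t => ∫ y : S2, F (P + t • (y : E3)) * ((y : E3) j * G y) ∂surf)
      (∫ y : S2, (pd j F (P + t • (y : E3)) * G y - t⁻¹ * (F (P + t • (y : E3)) *
        (2 * ((y : E3) j * G y) - pd j G y + (y : E3) j * ∑ i, (y : E3) i * pd i G y))) ∂surf) t := by
  have hH : ContDiff ℝ ∞ fun z : ℝ × E3 => F (P + z.1 • z.2) * (z.2 j * G z.2) := by fun_prop
  have hS : ContDiff ℝ ∞ fun x : E3 => F (P + t • x) := by fun_prop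
  have hd (x : E3) : HasDerivAt (fun s : ℝ => F (P + s • x) * (x j * G x))
      ((∑ i, x i * pd i F (P + t • x)) * (x j * G x)) t := by
    have h1 : HasDerivAt (fun s : ℝ => P + s • x) x t := by
      simpa using ((hasDerivAt_id t).smul_const x).const_add P
    have h2 := ((hF.differentiable (by simp)) (P + t • x)).hasFDerivAt.comp_hasDerivAt t h1
    rw [fderiv_self_eq_sum] at h2
    exact h2.mul_const _
  refine (hasDerivAt_sphere_integral hH hd).congr_deriv ?_
  have hpF : ∀ i, Continuous (pd i F) := fun i => (contDiff_pd hF i).continuous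
  have hpG : ∀ i, Continuous (pd i G) := fun i => (contDiff_pd hG i).continuous
  have hFc := hF.continuous
  have hGc := hG.continuous
  rw [← sub_eq_zero, ← integral_sub]
  -- The quantity y_j ∂_r F differs from ∂_j F by a tangential derivative, which is t⁻¹ times that
  -- of y ↦ F (P + t • y); the divergence theorem moves it onto the weight.
  · have key := integral_tangential_deriv (hS.mul hG) j
    have : ∀ y : S2, (∑ i, (y : E3) i * pd i F (P + t • (y : E3))) * ((y : E3) j * G y) -
        (pd j F (P + t • (y : E3)) * G y - t⁻¹ * (F (P + t • (y : E3)) *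
        (2 * ((y : E3) j * G y) - pd j G y + (y : E3) j * ∑ i, (y : E3) i * pd i G y))) =
        -t⁻¹ * (pd j (fun x => F (P + t • x) * G x) y - (y : E3) j *
          ∑ i, (y : E3) i * pd i (fun x => F (P + t • x) * G x) y -
          2 * ((y : E3) j * (F (P + t • (y : E3)) * G y))) := by
      intro y
      simp only [pd_mul hS hG, pd_scale hF, Fin.sum_univ_three]
      field_simp
      ring
    simp only [this]
    rw [integral_const_mul]
    exact mul_eq_zero_of_right _ key
  · exact integrable_surf (by fun_prop)
  · exact integrable_surf (by fun_prop)

end Divergence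

/-! ### Radial derivatives of integrals with weights depending on cos θ. -/

section Zonal

/-- The integral of `F` over the sphere of radius `t` centred at `P` with the weight `Q(cos θ)`. -/
def zonalInt (F : E3 → ℝ) (P : E3) (Q : ℝ[X]) (t : ℝ) : ℝ :=
  ∫ y : S2, F (P + t • (y : E3)) * Q.eval ((y : E3) 2) ∂surf

/-- The integral over the sphere of radius `t` centred at `P`, with the weight `Q(cos θ)`, of the
horizontal part of the radial derivative of `F`. -/
def horizInt (F : E3 → ℝ) (P : E3) (Q : ℝ[X]) (t : ℝ) : ℝ :=
  ∫ y : S2, (pd 0 F (P + t • (y : E3)) * (y : E3) 0 + pd 1 F (P + t • (y : E3)) * (y : E3) 1) *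
    Q.eval ((y : E3) 2) ∂surf

/-- The horizontal Laplace operator `∂²/∂x₀² + ∂²/∂x₁²` on functions on `ℝ³`. -/
def hlap (F : E3 → ℝ) (x : E3) : ℝ := pd 0 (pd 0 F) x + pd 1 (pd 1 F) x

lemma contDiff_hlap {F : E3 → ℝ} (h : ContDiff ℝ ∞ F) : ContDiff ℝ ∞ (hlap F) :=
  (contDiff_pd (contDiff_pd h 0) 0).add (contDiff_pd (contDiff_pd h 1) 1)

variable {F : E3 → ℝ} (hF : ContDiff ℝ ∞ F) (P : E3)

include hF

lemma contDiff_zonalInt (Q : ℝ[X]) : ContDiff ℝ ∞ (zonalInt F P Q) := by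
  refine contDiff_sphere_integral (H := fun z : ℝ × E3 => F (P + z.1 • z.2) * Q.eval (z.2 2)) ?_
  have hQ : ContDiff ℝ ∞ fun z : ℝ × E3 => Q.eval (z.2 2) :=
    (contDiff_eval_coord Q).comp contDiff_snd
  fun_prop

lemma contDiff_horizInt (Q : ℝ[X]) : ContDiff ℝ ∞ (horizInt F P Q) := by
  refine contDiff_sphere_integral (H := fun z : ℝ × E3 =>
    (pd 0 F (P + z.1 • z.2) * z.2 0 + pd 1 F (P + z.1 • z.2) * z.2 1) * Q.eval (z.2 2)) ?_
  have hQ : ContDiff ℝ ∞ fun z : ℝ × E3 => Q.eval (z.2 2) :=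
    (contDiff_eval_coord Q).comp contDiff_snd
  have := contDiff_pd hF 0
  have := contDiff_pd hF 1
  fun_prop

lemma zonalInt_add (Q R : ℝ[X]) (t : ℝ) :
    zonalInt F P (Q + R) t = zonalInt F P Q t + zonalInt F P R t := by
  have := hF.continuous
  have h1 := (contDiff_eval_coord Q).continuous
  have h2 := (contDiff_eval_coord R).continuous
  simp only [zonalInt, eval_add, mul_add]
  exact integral_add (integrable_surf (by fun_prop)) (integrable_surf (by fun_prop))

omit hF in
lemma zonalInt_C_mul (r : ℝ) (Q : ℝ[X]) (t : ℝ) :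
    zonalInt F P (C r * Q) t = r * zonalInt F P Q t := by
  simp only [zonalInt, eval_mul, eval_C, ← integral_const_mul]
  congr 1; ext y; ring

lemma horizInt_add (Q R : ℝ[X]) (t : ℝ) :
    horizInt F P (Q + R) t = horizInt F P Q t + horizInt F P R t := by
  have := (contDiff_pd hF 0).continuous
  have := (contDiff_pd hF 1).continuous
  have h1 := (contDiff_eval_coord Q).continuous
  have h2 := (contDiff_eval_coord R).continuous
  simp only [horizInt, eval_add, mul_add]
  exact integral_add (integrable_surf (by fun_prop)) (integrable_surf (by fun_prop))

omit hF in
lemma horizInt_C_mul (r : ℝ) (Q : ℝ[X]) (t : ℝ) :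
    horizInt F P (C r * Q) t = r * horizInt F P Q t := by
  simp only [horizInt, eval_mul, eval_C, ← integral_const_mul]
  congr 1; ext y; ring

/-- On the sphere 1 - y_2² = y_0² + y_1², so the weight splits into y_0 (y_0 Q) and y_1 (y_1 Q). The
factor 1 - x² thus ensures that only horizontal derivatives of F occur. -/
lemma hasDerivAt_zonalInt (Q : ℝ[X]) {t : ℝ} (ht : t ≠ 0) :
    HasDerivAt (zonalInt F P ((1 - X ^ 2) * Q))
      (horizInt F P Q t -
        t⁻¹ * zonalInt F P ((1 - 3 * X ^ 2) * Q + (1 - X ^ 2) * (X * derivative Q)) t) t := by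
  have hQ := contDiff_eval_coord Q
  have hQ' := (contDiff_eval_coord (derivative Q)).continuous
  have hG (j : Fin 3) : ContDiff ℝ ∞ fun x : E3 => x j * Q.eval (x 2) := (contDiff_coord j).mul hQ
  have h0 := hasDerivAt_integral_coord_mul hF (hG 0) 0 P ht
  have h1 := hasDerivAt_integral_coord_mul hF (hG 1) 1 P ht
  have hpF : ∀ i, Continuous (pd i F) := fun i => (contDiff_pd hF i).continuous
  have hp0 : ∀ i, Continuous (pd i _) := fun i => (contDiff_pd (hG 0) i).continuous
  have hp1 : ∀ i, Continuous (pd i _) := fun i => (contDiff_pd (hG 1) i).continuous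
  have hFc := hF.continuous
  have hQc := hQ.continuous
  have hadd := h0.add h1
  have hfun : zonalInt F P ((1 - X ^ 2) * Q) =
      (fun t => ∫ y : S2, F (P + t • (y : E3)) * ((y : E3) 0 *
        ((y : E3) 0 * Q.eval ((y : E3) 2))) ∂surf) +
      fun t => ∫ y : S2, F (P + t • (y : E3)) * ((y : E3) 1 *
        ((y : E3) 1 * Q.eval ((y : E3) 2))) ∂surf := by
    ext t
    simp only [Pi.add_apply, zonalInt]
    rw [← integral_add (integrable_surf (by fun_prop)) (integrable_surf (by fun_prop))]
    congr 1
    ext y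
    have hy := sum_sq_coord y
    rw [Fin.sum_univ_three] at hy
    simp only [eval_mul, eval_sub, eval_one, eval_pow, eval_X]
    linear_combination F (P + t • (y : E3)) * Q.eval ((y : E3) 2) * (-hy)
  rw [hfun]
  refine hadd.congr_deriv ?_
  rw [← integral_add (integrable_surf (by fun_prop)) (integrable_surf (by fun_prop)), horizInt,
    zonalInt, ← integral_const_mul, ← integral_sub (integrable_surf (by fun_prop))
      (integrable_surf (by
        simp only [eval_add, eval_mul, eval_sub, eval_one, eval_pow, eval_X]; fun_prop))]
  congr 1
  ext y
  have hy := sum_sq_coord y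
  rw [Fin.sum_univ_three] at hy
  simp only [pd_mul (contDiff_coord _) hQ, pd_coord, pd_eval, Fin.sum_univ_three, eval_add,
    eval_mul, eval_sub, eval_one, eval_pow, eval_X, eval_ofNat]
  simp
  linear_combination -t⁻¹ * F (P + t • (y : E3)) * (3 * Q.eval ((y : E3) 2) +
    (y : E3) 2 * (derivative Q).eval ((y : E3) 2)) * hy

/-- The integrand already carries y_0 with ∂_0 F and y_1 with ∂_1 F, so converting each radial
derivative produces ∂_0² F + ∂_1² F. -/
lemma hasDerivAt_horizInt (Q : ℝ[X]) {t : ℝ} (ht : t ≠ 0) :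
    HasDerivAt (horizInt F P Q)
      (zonalInt (hlap F) P Q t - t⁻¹ * horizInt F P (C 2 * Q + X * derivative Q) t) t := by
  have hQ := contDiff_eval_coord Q
  have hQ' := (contDiff_eval_coord (derivative Q)).continuous
  have h0 := hasDerivAt_integral_coord_mul (contDiff_pd hF 0) hQ 0 P ht
  have h1 := hasDerivAt_integral_coord_mul (contDiff_pd hF 1) hQ 1 P ht
  have hpF : ∀ i, Continuous (pd i F) := fun i => (contDiff_pd hF i).continuous
  have hpF' : ∀ j i, Continuous (pd j (pd i F)) := fun j i =>
    (contDiff_pd (contDiff_pd hF i) j).continuous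
  have hp : ∀ i, Continuous (pd i _) := fun i => (contDiff_pd hQ i).continuous
  have hL := (contDiff_hlap hF).continuous
  have hQc := hQ.continuous
  have hadd := h0.add h1
  have hfun : horizInt F P Q =
      (fun t => ∫ y : S2, pd 0 F (P + t • (y : E3)) *
        ((y : E3) 0 * Q.eval ((y : E3) 2)) ∂surf) +
      fun t => ∫ y : S2, pd 1 F (P + t • (y : E3)) *
        ((y : E3) 1 * Q.eval ((y : E3) 2)) ∂surf := by
    ext t
    simp only [Pi.add_apply, horizInt]
    rw [← integral_add (integrable_surf (by fun_prop)) (integrable_surf (by fun_prop))]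
    congr 1
    ext y
    ring
  rw [hfun]
  refine hadd.congr_deriv ?_
  rw [← integral_add (integrable_surf (by fun_prop)) (integrable_surf (by fun_prop)), horizInt,
    zonalInt, ← integral_const_mul, ← integral_sub (integrable_surf (by fun_prop))
      (integrable_surf (by simp only [eval_add, eval_mul, eval_C, eval_X]; fun_prop))]
  congr 1
  ext y
  simp only [pd_eval, Fin.sum_univ_three, eval_add, eval_mul, eval_C, eval_X, hlap]
  simp
  ring

end Zonal

end SphericalCoeffs

namespace SphericalCoeffs

open MeasureTheory Metric Polynomial
open scoped ContDiff

/-! ### The expansion coefficients of f as weighted integrals, and their two differential equations.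
-/

section Coefficients

/-- The centre `(p, q, 0)`. -/
def ctr (p q : ℝ) : E3 := !₂[p, q, 0]

lemma ctr_eq (p q : ℝ) : ctr p q = p • basisVec 0 + q • basisVec 1 := by
  ext i
  fin_cases i <;> simp [ctr, basisVec]

lemma contDiff_ctr : ContDiff ℝ ∞ fun z : ℝ × ℝ => ctr z.1 z.2 := by
  simp only [ctr_eq]
  fun_prop

lemma cos_polarAngle (y : S2) : Real.cos (polarAngle y) = (y : E3) 2 := by
  have h := sum_sq_coord y
  rw [Fin.sum_univ_three] at h
  have : |(y : E3) 2| ≤ 1 := by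
    rw [← sq_le_one_iff_abs_le_one]
    nlinarith [sq_nonneg ((y : E3) 0), sq_nonneg ((y : E3) 1)]
  exact Real.cos_arccos (abs_le.1 this).1 (abs_le.1 this).2

lemma sqrt_one_sub_sq (y : S2) :
    √(1 - (y : E3) 2 ^ 2) = ‖(⟨(y : E3) 0, (y : E3) 1⟩ : ℂ)‖ := by
  have h := sum_sq_coord y
  rw [Fin.sum_univ_three] at h
  rw [Complex.norm_def, Complex.normSq_mk]
  congr 1
  linarith

/-- With its sine counterpart, this turns P_{n1}(cos θ) cos φ and P_{n1}(cos θ) sin φ into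
polynomials in y. At the poles the square root vanishes, so the conventional azimuth there does not
matter. -/
lemma sqrt_mul_cos_azimuth (y : S2) :
    √(1 - (y : E3) 2 ^ 2) * Real.cos (azimuth y) = (y : E3) 0 := by
  rw [sqrt_one_sub_sq]
  exact Complex.norm_mul_cos_arg _

lemma sqrt_mul_sin_azimuth (y : S2) :
    √(1 - (y : E3) 2 ^ 2) * Real.sin (azimuth y) = (y : E3) 1 := by
  rw [sqrt_one_sub_sq]
  exact Complex.norm_mul_sin_arg _

lemma sphMean_eq (f : E3 → ℝ) (p q t : ℝ) :
    sphMean f p q t = 1 / (4 * Real.pi) * zonalInt f (ctr p q) 1 t := by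
  simp [sphMean, zonalInt, restr, ctr]

lemma zonalCoeff_eq (f : E3 → ℝ) (n : ℕ) (p q t : ℝ) :
    zonalCoeff f n p q t = (2 * n + 1) / (4 * Real.pi) * zonalInt f (ctr p q) (legendre n) t := by
  simp only [zonalCoeff, zonalInt, restr, ctr, cos_polarAngle]

lemma cosCoeff_one_eq (f : E3 → ℝ) (n : ℕ) (p q t : ℝ) :
    cosCoeff f 1 n p q t = (2 * n + 1) / (2 * Real.pi) * ((n - 1).factorial / (n + 1).factorial) *
      ∫ y : S2, f (ctr p q + t • (y : E3)) *
        ((y : E3) 0 * (derivative (legendre n)).eval ((y : E3) 2)) ∂surf := by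
  simp only [cosCoeff, restr, ctr, cos_polarAngle, assocLegendre, pow_one, Nat.cast_one, one_mul,
    Function.iterate_one]
  congr 2
  ext y
  rw [← sqrt_mul_cos_azimuth y]
  ring

lemma sinCoeff_one_eq (f : E3 → ℝ) (n : ℕ) (p q t : ℝ) :
    sinCoeff f 1 n p q t = (2 * n + 1) / (2 * Real.pi) * ((n - 1).factorial / (n + 1).factorial) *
      ∫ y : S2, f (ctr p q + t • (y : E3)) *
        ((y : E3) 1 * (derivative (legendre n)).eval ((y : E3) 2)) ∂surf := by
  simp only [sinCoeff, restr, ctr, cos_polarAngle, assocLegendre, pow_one, Nat.cast_one, one_mul,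
    Function.iterate_one]
  congr 2
  ext y
  rw [← sqrt_mul_sin_azimuth y]
  ring

variable {f : E3 → ℝ} (hf : ContDiff ℝ ∞ f)

include hf

/-- Differentiation in the centre of an integral over a sphere. -/
lemma hasDerivAt_integral_centre {g : E3 → ℝ} (hg : ContDiff ℝ ∞ g) {γ : ℝ → E3}
    (hγ : ContDiff ℝ ∞ γ) {j : Fin 3} {p : ℝ} (hγ' : HasDerivAt γ (basisVec j) p) (t : ℝ) :
    HasDerivAt (fun x => ∫ y : S2, f (γ x + t • (y : E3)) * g y ∂surf)
      (∫ y : S2, pd j f (γ p + t • (y : E3)) * g y ∂surf) p := by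
  refine hasDerivAt_sphere_integral (H := fun z : ℝ × E3 => f (γ z.1 + t • z.2) * g z.2)
    (H' := fun x => pd j f (γ p + t • x) * g x) (by fun_prop) fun x => ?_
  exact (((hf.differentiable (by simp)) (γ p + t • x)).hasFDerivAt.comp_hasDerivAt p
    (hγ'.add_const (t • x))).mul_const (g x)

omit hf in
lemma hasDerivAt_ctr_fst (p q : ℝ) : HasDerivAt (fun x => ctr x q) (basisVec 0) p := by
  simp only [ctr_eq]
  simpa using ((hasDerivAt_id p).smul_const (basisVec 0)).add_const (q • basisVec 1)

omit hf in
lemma hasDerivAt_ctr_snd (p q : ℝ) : HasDerivAt (fun y => ctr p y) (basisVec 1) q := by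
  simp only [ctr_eq]
  simpa using ((hasDerivAt_id q).smul_const (basisVec 1)).const_add (p • basisVec 0)

omit hf in
lemma contDiff_ctr_fst (q : ℝ) : ContDiff ℝ ∞ fun x => ctr x q :=
  contDiff_ctr.comp (contDiff_id.prodMk contDiff_const)

omit hf in
lemma contDiff_ctr_snd (p : ℝ) : ContDiff ℝ ∞ fun y => ctr p y :=
  contDiff_ctr.comp (contDiff_const.prodMk contDiff_id)

lemma hasDerivAt_sphMean_fst (p q t : ℝ) :
    HasDerivAt (fun x => sphMean f x q t) (sphMean (pd 0 f) p q t) p := by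
  have := (hasDerivAt_integral_centre hf (g := 1) contDiff_const (contDiff_ctr_fst q)
    (hasDerivAt_ctr_fst p q) t).const_mul (1 / (4 * Real.pi))
  simpa [sphMean, restr, ctr] using this

lemma hasDerivAt_sphMean_snd (p q t : ℝ) :
    HasDerivAt (fun y => sphMean f p y t) (sphMean (pd 1 f) p q t) q := by
  have := (hasDerivAt_integral_centre hf (g := 1) contDiff_const (contDiff_ctr_snd p)
    (hasDerivAt_ctr_snd p q) t).const_mul (1 / (4 * Real.pi))
  simpa [sphMean, restr, ctr] using this

lemma lap_sphMean (p q t : ℝ) :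
    lap (fun x y => sphMean f x y t) p q = sphMean (hlap f) p q t := by
  have h0 : (deriv fun x => sphMean f x q t) = fun x => sphMean (pd 0 f) x q t :=
    funext fun x => (hasDerivAt_sphMean_fst hf x q t).deriv
  have h1 : (deriv fun y => sphMean f p y t) = fun y => sphMean (pd 1 f) p y t :=
    funext fun y => (hasDerivAt_sphMean_snd hf p y t).deriv
  rw [lap, h0, h1, (hasDerivAt_sphMean_fst (contDiff_pd hf 0) p q t).deriv,
    (hasDerivAt_sphMean_snd (contDiff_pd hf 1) p q t).deriv]
  have h2 := (contDiff_pd (contDiff_pd hf 0) 0).continuous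
  have h3 := (contDiff_pd (contDiff_pd hf 1) 1).continuous
  simp only [sphMean, restr, hlap]
  rw [integral_add (integrable_surf (by fun_prop)) (integrable_surf (by fun_prop)), mul_add]

lemma contDiff_iterate_hlap (i : ℕ) : ContDiff ℝ ∞ (hlap^[i] f) := by
  induction i with
  | zero => exact hf
  | succ i ih => rw [Function.iterate_succ_apply']; exact contDiff_hlap ih

/-- Differentiation in the centre passes under the integral, so Laplacians of means are means of
other smooth functions. -/
lemma lapMean_eq (i : ℕ) (p q u : ℝ) : lapMean f i p q u = sphMean (hlap^[i] f) p q u := by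
  have : (lap^[i] fun x y => sphMean f x y u) = fun x y => sphMean (hlap^[i] f) x y u := by
    induction i with
    | zero => rfl
    | succ i ih =>
      rw [Function.iterate_succ_apply', Function.iterate_succ_apply', ih]
      ext x y
      exact lap_sphMean (contDiff_iterate_hlap hf i) x y u
  rw [lapMean, this]

lemma lapMean_hlap (i : ℕ) (p q u : ℝ) : lapMean (hlap f) i p q u = lapMean f (i + 1) p q u := by
  rw [lapMean_eq (contDiff_hlap hf), lapMean_eq hf, Function.iterate_succ_apply]

lemma contDiff_sphMean_centre (u : ℝ) :
    ContDiff ℝ ∞ fun z : ℝ × ℝ => sphMean f z.1 z.2 u := by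
  have hH : ContDiff ℝ ∞ fun z : (ℝ × ℝ) × E3 => f (ctr z.1.1 z.1.2 + u • z.2) := by
    have := contDiff_ctr.comp (contDiff_fst : ContDiff ℝ ∞ (Prod.fst : (ℝ × ℝ) × E3 → ℝ × ℝ))
    exact hf.comp (this.add (by fun_prop))
  exact contDiff_const.mul (contDiff_sphere_integral hH)

lemma contDiff_lapMean (i : ℕ) (p q : ℝ) : ContDiff ℝ ∞ (lapMean f i p q) := by
  have : lapMean f i p q = fun u => 1 / (4 * Real.pi) * zonalInt (hlap^[i] f) (ctr p q) 1 u := by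
    ext u
    rw [lapMean_eq hf, sphMean_eq]
  rw [this]
  exact contDiff_const.mul (contDiff_zonalInt (contDiff_iterate_hlap hf i) _ _)

lemma contDiff_zonalCoeff (n : ℕ) (p q : ℝ) : ContDiff ℝ ∞ (zonalCoeff f n p q) := by
  have : zonalCoeff f n p q = fun t => (2 * n + 1) / (4 * Real.pi) *
      zonalInt f (ctr p q) (legendre n) t := funext fun t => zonalCoeff_eq f n p q t
  rw [this]
  exact contDiff_const.mul (contDiff_zonalInt hf _ _)

omit hf in
/-- The divergence `∂_p a_{1n} + ∂_q b_{1n}`. -/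
def divCoeff (f : E3 → ℝ) (n : ℕ) (p q t : ℝ) : ℝ :=
  (2 * n + 1) / (2 * Real.pi) * ((n - 1).factorial / (n + 1).factorial) *
    horizInt f (ctr p q) (derivative (legendre n)) t

lemma contDiff_divCoeff (n : ℕ) (p q : ℝ) : ContDiff ℝ ∞ (divCoeff f n p q) :=
  contDiff_const.mul (contDiff_horizInt hf _ _)

lemma hasDerivAt_cosCoeff (n : ℕ) (p q t : ℝ) :
    HasDerivAt (fun x => cosCoeff f 1 n x q t)
      ((2 * n + 1) / (2 * Real.pi) * ((n - 1).factorial / (n + 1).factorial) *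
        ∫ y : S2, pd 0 f (ctr p q + t • (y : E3)) *
          ((y : E3) 0 * (derivative (legendre n)).eval ((y : E3) 2)) ∂surf) p := by
  simp only [cosCoeff_one_eq]
  exact (hasDerivAt_integral_centre hf ((contDiff_coord 0).mul (contDiff_eval_coord _))
    (contDiff_ctr_fst q) (hasDerivAt_ctr_fst p q) t).const_mul _

lemma hasDerivAt_sinCoeff (n : ℕ) (p q t : ℝ) :
    HasDerivAt (fun y => sinCoeff f 1 n p y t)
      ((2 * n + 1) / (2 * Real.pi) * ((n - 1).factorial / (n + 1).factorial) *
        ∫ y : S2, pd 1 f (ctr p q + t • (y : E3)) *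
          ((y : E3) 1 * (derivative (legendre n)).eval ((y : E3) 2)) ∂surf) q := by
  simp only [sinCoeff_one_eq]
  exact (hasDerivAt_integral_centre hf ((contDiff_coord 1).mul (contDiff_eval_coord _))
    (contDiff_ctr_snd p) (hasDerivAt_ctr_snd p q) t).const_mul _

lemma deriv_cosCoeff_add_deriv_sinCoeff (n : ℕ) (p q t : ℝ) :
    deriv (fun x => cosCoeff f 1 n x q t) p + deriv (fun y => sinCoeff f 1 n p y t) q =
      divCoeff f n p q t := by
  have h0 := (contDiff_pd hf 0).continuous
  have h1 := (contDiff_pd hf 1).continuous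
  have hQ := (contDiff_eval_coord (derivative (legendre n))).continuous
  rw [(hasDerivAt_cosCoeff hf n p q t).deriv, (hasDerivAt_sinCoeff hf n p q t).deriv, ← mul_add,
    ← integral_add (integrable_surf (by fun_prop)) (integrable_surf (by fun_prop)), divCoeff,
    horizInt]
  congr 2
  ext y
  ring

omit hf in
lemma factorial_ratio (n : ℕ) :
    (n.factorial / (n + 1 + 1).factorial : ℝ) = 1 / ((n + 1) * (n + 2)) := by
  rw [Nat.factorial_succ, Nat.factorial_succ]
  have : (n.factorial : ℝ) ≠ 0 := by positivity
  push_cast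
  field_simp
  ring

/-- The differential equation relating `∂_p a_{1n} + ∂_q b_{1n}` to `a_{0(n-1)}` and
`a_{0(n+1)}`, where `n = 2k + 1`. -/
lemma divCoeff_eq (k : ℕ) (p q : ℝ) {t : ℝ} (ht : t ≠ 0) :
    divCoeff f (2 * k + 1) p q t =
      2 * ((deriv (zonalCoeff f (2 * k) p q) t - 2 * k * t⁻¹ * zonalCoeff f (2 * k) p q t) /
          (4 * k + 1) -
        (deriv (zonalCoeff f (2 * (k + 1)) p q) t +
          (2 * k + 3) * t⁻¹ * zonalCoeff f (2 * (k + 1)) p q t) / (4 * k + 5)) := by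
  set P := ctr p q with hP
  set n := 2 * k + 1 with hn
  have hd (j : ℕ) : HasDerivAt (zonalInt f P (legendre j)) (deriv (zonalInt f P (legendre j)) t) t :=
    (((contDiff_zonalInt hf P _).differentiable (by simp)) t).hasDerivAt
  have hz (j : ℕ) : deriv (zonalCoeff f j p q) t =
      (2 * j + 1) / (4 * Real.pi) * deriv (zonalInt f P (legendre j)) t := by
    have : zonalCoeff f j p q = fun t => (2 * j + 1) / (4 * Real.pi) *
      zonalInt f P (legendre j) t := funext fun t => zonalCoeff_eq f j p q t
    rw [this]
    exact ((hd j).const_mul _).deriv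
  -- Up to constants the weight (1 - x²) P_n' is P_{n-1} - P_{n+1}. Its integral is differentiated
  -- both by `hasDerivAt_zonalInt` and termwise; equating the results gives the equation.
  have h1 := (hasDerivAt_zonalInt hf P (derivative (legendre n)) ht).const_mul (2 * n + 1 : ℝ)
  have hC := one_sub_X_sq_mul_derivative_legendre n
  have hD := one_sub_X_sq_mul_derivative_legendre_add n
  have hsub (Q R : ℝ[X]) (t : ℝ) : zonalInt f P (Q - R) t = zonalInt f P Q t - zonalInt f P R t := by
    have h := zonalInt_add hf P Q (C (-1) * R) t
    rw [zonalInt_C_mul] at h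
    simp only [C_neg, C_1] at h
    rw [sub_eq_add_neg, ← neg_one_mul R, h]
    ring
  have hfun : (fun t => (2 * n + 1 : ℝ) * zonalInt f P ((1 - X ^ 2) * derivative (legendre n)) t) =
      fun t => (n * (n + 1) : ℝ) * (zonalInt f P (legendre (2 * k)) t -
        zonalInt f P (legendre (2 * (k + 1))) t) := by
    ext t
    rw [← zonalInt_C_mul, hC, zonalInt_C_mul, hsub]
    rfl
  rw [hfun] at h1
  have h2 := h1.unique (((hd (2 * k)).sub (hd (2 * (k + 1)))).const_mul _)
  have h3 : (2 * n + 1 : ℝ) * zonalInt f P ((1 - 3 * X ^ 2) * derivative (legendre n) +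
      (1 - X ^ 2) * (X * derivative (derivative (legendre n)))) t =
      -((n * (n + 1) : ℝ) * ((n - 1) * zonalInt f P (legendre (2 * k)) t +
        (n + 2) * zonalInt f P (legendre (2 * (k + 1))) t)) := by
    rw [← zonalInt_C_mul, hD, ← mul_neg, zonalInt_C_mul, ← neg_one_mul, ← C_1, ← C_neg,
      zonalInt_C_mul, zonalInt_add hf, zonalInt_C_mul, zonalInt_C_mul]
    simp only [hn, Nat.add_sub_cancel]
    rw [show 2 * k + 1 + 1 = 2 * (k + 1) by ring]
    ring
  rw [divCoeff, hz, hz, zonalCoeff_eq, zonalCoeff_eq, show n - 1 = 2 * k from rfl,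
    factorial_ratio, ← hP]
  have hpi := Real.pi_ne_zero
  have h4 : horizInt f P (derivative (legendre n)) t = (n * (n + 1) : ℝ) / (2 * n + 1) *
      (deriv (zonalInt f P (legendre (2 * k))) t - deriv (zonalInt f P (legendre (2 * (k + 1)))) t -
        t⁻¹ * ((n - 1) * zonalInt f P (legendre (2 * k)) t +
        (n + 2) * zonalInt f P (legendre (2 * (k + 1))) t)) := by
    have : (2 * n + 1 : ℝ) ≠ 0 := by positivity
    rw [div_mul_eq_mul_div, eq_div_iff this]
    linear_combination h2 + t⁻¹ * h3
  rw [h4]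
  rw [hn]
  push_cast
  field_simp
  ring

/-- The differential equation relating `Δ a_{0n}` to `∂_p a_{1(n±1)} + ∂_q b_{1(n±1)}`,
where `n = 2k`. -/
lemma zonalCoeff_hlap_eq (k : ℕ) (p q : ℝ) {t : ℝ} (ht : t ≠ 0) :
    2 * zonalCoeff (hlap f) (2 * k) p q t =
      (2 * k + 2) * (2 * k + 1) / (4 * k + 3) *
        (deriv (divCoeff f (2 * (k + 1) - 1) p q) t +
          (2 * k + 2) * t⁻¹ * divCoeff f (2 * (k + 1) - 1) p q t) -
      2 * k * (2 * k - 1) / (4 * k - 1) *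
        (deriv (divCoeff f (2 * k - 1) p q) t -
          (2 * k - 1) * t⁻¹ * divCoeff f (2 * k - 1) p q t) := by
  set P := ctr p q with hP
  set L : ℕ → ℝ[X] := fun j => derivative (legendre j)
  have hd (j : ℕ) : HasDerivAt (horizInt f P (L j)) (deriv (horizInt f P (L j)) t) t :=
    (((contDiff_horizInt hf P _).differentiable (by simp)) t).hasDerivAt
  have hz (j : ℕ) : deriv (divCoeff f j p q) t =
      (2 * j + 1) / (2 * Real.pi) * ((j - 1).factorial / (j + 1).factorial) *
        deriv (horizInt f P (L j)) t :=
    ((hd j).const_mul _).deriv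
  have hA := legendre_eq_derivative_sub (2 * k)
  have hB := X_mul_derivative_legendre (2 * k)
  have hsub (Q R : ℝ[X]) (t : ℝ) : horizInt f P (Q - R) t = horizInt f P Q t - horizInt f P R t := by
    have h := horizInt_add hf P Q (C (-1) * R) t
    rw [horizInt_C_mul] at h
    simp only [C_neg, C_1] at h
    rw [sub_eq_add_neg, ← neg_one_mul R, h]
    ring
  -- The same double computation, now with (2n+1) P_n = P_{n+1}' - P_{n-1}' for n = 2k.
  have h1 := (hasDerivAt_horizInt hf P (legendre (2 * k)) ht).const_mul (2 * (2 * k : ℕ) + 1 : ℝ)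
  have hfun : (fun t => (2 * (2 * k : ℕ) + 1 : ℝ) * horizInt f P (legendre (2 * k)) t) =
      fun t => horizInt f P (L (2 * k + 1)) t - horizInt f P (L (2 * k - 1)) t := by
    ext t
    rw [← horizInt_C_mul, hA, hsub]
  rw [hfun] at h1
  have h2 := h1.unique ((hd (2 * k + 1)).sub (hd (2 * k - 1)))
  have h3 : (2 * (2 * k : ℕ) + 1 : ℝ) * horizInt f P (C 2 * legendre (2 * k) +
      X * derivative (legendre (2 * k))) t =
      (2 * k + 2) * horizInt f P (L (2 * k + 1)) t +
        (2 * k - 1) * horizInt f P (L (2 * k - 1)) t := by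
    rw [horizInt_add hf, mul_add, ← horizInt_C_mul, ← horizInt_C_mul, hB, mul_left_comm, hA,
      horizInt_C_mul, hsub, horizInt_add hf, horizInt_C_mul, horizInt_C_mul]
    push_cast
    ring
  have h4 : (4 * k + 1 : ℝ) * zonalInt (hlap f) P (legendre (2 * k)) t =
      (deriv (horizInt f P (L (2 * k + 1))) t +
        (2 * k + 2) * t⁻¹ * horizInt f P (L (2 * k + 1)) t) -
      (deriv (horizInt f P (L (2 * k - 1))) t -
        (2 * k - 1) * t⁻¹ * horizInt f P (L (2 * k - 1)) t) := by
    push_cast at h2 h3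
    linear_combination h2 + t⁻¹ * h3
  have hpi := Real.pi_ne_zero
  rw [hz, hz, zonalCoeff_eq, ← hP]
  simp only [divCoeff]
  rw [← hP, show 2 * (k + 1) - 1 = 2 * k + 1 by omega, Nat.add_sub_cancel, factorial_ratio]
  change _ = _ * (_ + _ * (_ * horizInt f P (L (2 * k + 1)) t)) -
    _ * (_ - _ * (_ * horizInt f P (L (2 * k - 1)) t))
  have h5 : (2 * (2 * (k : ℕ) : ℕ) + 1 : ℝ) / (4 * Real.pi) *
      zonalInt (hlap f) P (legendre (2 * k)) t = 1 / (4 * Real.pi) *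
      ((4 * k + 1 : ℝ) * zonalInt (hlap f) P (legendre (2 * k)) t) := by
    push_cast
    ring
  rw [h5, h4]
  rcases k with _ | k
  -- For k = 0 the index 2k - 1 truncates to 0, where `factorial_ratio` does not apply; the term
  -- drops out because P_0' = 0.
  · have : L 0 = 0 := by simp [L, legendre_zero]
    have h0 : horizInt f P 0 = 0 := by ext; simp [horizInt]
    simp [this, h0]
    field_simp
    ring
  · rw [show 2 * (k + 1) - 1 = 2 * k + 1 by omega, Nat.add_sub_cancel, factorial_ratio]
    rw [show (4 * (k + 1 : ℕ) - 1 : ℝ) = 4 * k + 3 by push_cast; ring]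
    push_cast
    field_simp
    ring

end Coefficients

end SphericalCoeffs

namespace SphericalCoeffs

open MeasureTheory Finset intervalIntegral
open scoped ContDiff

/-! ### Sums of moments, and uniqueness for the singular radial equation. -/

section RadialSum

/-- The moment `∫₀ᵗ u^{2m} N(u) du`. -/
def moment (N : ℝ → ℝ) (m : ℕ) (t : ℝ) : ℝ := ∫ u in (0 : ℝ)..t, u ^ (2 * m) * N u

/-- The sum `∑_j ∑_m b_{jm} t^{2j+r-2m} ∫₀ᵗ u^{2m} N_j(u) du`, linear in `b`. -/
def momentSum (n M : ℕ) (r : ℤ) (N : ℕ → ℝ → ℝ) (t : ℝ) : (ℕ → ℕ → ℝ) →ₗ[ℝ] ℝ where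
  toFun b := ∑ j ∈ range n, ∑ m ∈ Icc 1 M, b j m * (t ^ (2 * j + r - 2 * m : ℤ) * moment (N j) m t)
  map_add' b b' := by simp [add_mul, sum_add_distrib]
  map_smul' a b := by simp [mul_sum, mul_assoc]

/-- The sum `∑_j (∑_m b_{jm}) t^{2j+r} N_j(t)`, linear in `b`. -/
def boundarySum (n M : ℕ) (r : ℤ) (N : ℕ → ℝ → ℝ) (t : ℝ) : (ℕ → ℕ → ℝ) →ₗ[ℝ] ℝ where
  toFun b := ∑ j ∈ range n, (∑ m ∈ Icc 1 M, b j m) * (t ^ (2 * j + r : ℤ) * N j t)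
  map_add' b b' := by simp [add_mul, sum_add_distrib]
  map_smul' a b := by simp [← mul_sum, mul_assoc]

/-- Multiplication of the coefficients `b_{jm}` by the exponents `2j+r-2m`. -/
def exponentMul (r : ℤ) (b : ℕ → ℕ → ℝ) (j m : ℕ) : ℝ := (2 * j + r - 2 * m : ℝ) * b j m

lemma momentSum_apply (n M : ℕ) (r : ℤ) (N : ℕ → ℝ → ℝ) (t : ℝ) (b : ℕ → ℕ → ℝ) :
    momentSum n M r N t b = ∑ j ∈ range n, ∑ m ∈ Icc 1 M,
      b j m * (t ^ (2 * j + r - 2 * m : ℤ) * moment (N j) m t) := rfl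

lemma boundarySum_apply (n M : ℕ) (r : ℤ) (N : ℕ → ℝ → ℝ) (t : ℝ) (b : ℕ → ℕ → ℝ) :
    boundarySum n M r N t b =
      ∑ j ∈ range n, (∑ m ∈ Icc 1 M, b j m) * (t ^ (2 * j + r : ℤ) * N j t) := rfl

lemma hasDerivAt_moment {N : ℝ → ℝ} (hN : Continuous N) (m : ℕ) (t : ℝ) :
    HasDerivAt (moment N m) (t ^ (2 * m) * N t) t := by
  have hc : Continuous fun u => u ^ (2 * m) * N u := by fun_prop
  exact integral_hasDerivAt_right (hc.intervalIntegrable _ _)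
    hc.aestronglyMeasurable.stronglyMeasurableAtFilter hc.continuousAt

lemma moment_zero (N : ℝ → ℝ) (m : ℕ) : moment N m 0 = 0 := integral_same

variable {n M : ℕ} {r : ℤ} {N : ℕ → ℝ → ℝ}

/-- Differentiating the power of t brings down the exponent. Differentiating the moment gives t^{2m}
N_j, which cancels t^{-2m}, so only the row sums of b enter the boundary part. -/
lemma hasDerivAt_momentSum (hN : ∀ j, Continuous (N j)) (b : ℕ → ℕ → ℝ) {t : ℝ} (ht : t ≠ 0) :
    HasDerivAt (fun t => momentSum n M r N t b)
      (t⁻¹ * momentSum n M r N t (exponentMul r b) + boundarySum n M r N t b) t := by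
  simp only [momentSum_apply, boundarySum_apply]
  have h := HasDerivAt.fun_sum (u := range n) fun j (_ : j ∈ range n) =>
    HasDerivAt.fun_sum (u := Icc 1 M) fun m (_ : m ∈ Icc 1 M) =>
      ((hasDerivAt_zpow (2 * j + r - 2 * m) t (Or.inl ht)).mul
        (hasDerivAt_moment (hN j) m t)).const_mul (b j m)
  refine h.congr_deriv ?_
  simp only [mul_sum, sum_mul, ← sum_add_distrib]
  refine sum_congr rfl fun j _ => sum_congr rfl fun m _ => ?_
  have h1 : t ^ (2 * j + r - 2 * m - 1 : ℤ) = t⁻¹ * t ^ (2 * j + r - 2 * m : ℤ) := by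
    rw [zpow_sub_one₀ ht, mul_comm]
  have h2 : t ^ (2 * j + r : ℤ) = t ^ (2 * j + r - 2 * m : ℤ) * t ^ (2 * m) := by
    rw [← zpow_natCast, ← zpow_add₀ ht]
    congr 1
    push_cast
    ring
  rw [h1, h2, exponentMul]
  push_cast
  ring

lemma momentSum_sub_one (b : ℕ → ℕ → ℝ) {t : ℝ} (ht : t ≠ 0) :
    momentSum n M (r - 1) N t b = t⁻¹ * momentSum n M r N t b := by
  simp only [momentSum_apply, mul_sum]
  refine sum_congr rfl fun j _ => sum_congr rfl fun m _ => ?_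
  rw [show (2 * j + (r - 1) - 2 * m : ℤ) = 2 * j + r - 2 * m - 1 by ring, zpow_sub_one₀ ht]
  ring

/-- Reconciles the sums for s, whose rows start at i = 1, with those for c, whose rows start at i =
0. -/
lemma momentSum_succ {b : ℕ → ℕ → ℝ} (hb : ∀ m, b 0 m = 0) (t : ℝ) :
    momentSum (n + 1) M r N t b =
      momentSum n M (r + 2) (fun j => N (j + 1)) t (fun j => b (j + 1)) := by
  simp only [momentSum_apply]
  rw [sum_range_succ']
  simp only [hb, zero_mul, sum_const_zero, add_zero]
  refine sum_congr rfl fun j _ => sum_congr rfl fun m _ => ?_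
  congr 3
  push_cast
  ring

/-- Uniqueness for the singular equation `h' + (α/t) h = g` among functions with
`t^α h(t) → 0` as `t → 0`. -/
lemma eq_momentSum (hN : ∀ j, Continuous (N j)) {h : ℝ → ℝ} (hh : Differentiable ℝ h) {α : ℕ}
    (hα : α ≠ 0) {b : ℕ → ℕ → ℝ} (hb : ∀ j m, b j m ≠ 0 → 0 ≤ 2 * j + r - 2 * m + α)
    (heq : ∀ t, 0 < t → deriv h t + α * t⁻¹ * h t =
      t⁻¹ * momentSum n M r N t (exponentMul r b) + boundarySum n M r N t b +
        α * t⁻¹ * momentSum n M r N t b) {t : ℝ} (ht : 0 < t) :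
    h t = momentSum n M r N t b := by
  -- For t > 0 this is t^α times the difference of the two sides. Natural exponents, legitimate by
  -- `hb`, make it continuous at 0 with value 0; its derivative vanishes for t > 0, so the mean
  -- value theorem gives g = 0.
  set g : ℝ → ℝ := fun t => t ^ α * h t - ∑ j ∈ range n, ∑ m ∈ Icc 1 M,
    b j m * (t ^ (2 * j + r - 2 * m + α : ℤ).toNat * moment (N j) m t) with hg
  have hgt : ∀ t, 0 < t → g t = t ^ α * (h t - momentSum n M r N t b) := by
    intro t ht
    rw [hg, mul_sub, momentSum_apply, mul_sum]
    simp only [mul_sum]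
    congr 1
    refine sum_congr rfl fun j _ => sum_congr rfl fun m _ => ?_
    by_cases hbm : b j m = 0
    · simp [hbm]
    · rw [← zpow_natCast t (Int.toNat _), Int.toNat_of_nonneg (hb j m hbm), zpow_add₀ ht.ne',
        zpow_natCast]
      ring
  have hg0 : g 0 = 0 := by simp [hg, moment_zero, hα]
  have hcm : ∀ j m, Continuous (moment (N j) m) := fun j m =>
    continuous_iff_continuousAt.2 fun t => (hasDerivAt_moment (hN j) m t).continuousAt
  have hgc : Continuous g := by
    have := hh.continuous
    fun_prop
  have hgd : ∀ x ∈ Set.Ioo 0 t, HasDerivAt g 0 x := by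
    rintro t ⟨ht, -⟩
    have h1 := (hasDerivAt_pow α t).mul ((hh t).hasDerivAt.sub
      (hasDerivAt_momentSum (n := n) (M := M) (r := r) hN b ht.ne'))
    refine (h1.congr_of_eventuallyEq ?_).congr_deriv ?_
    · filter_upwards [lt_mem_nhds ht] with u hu using hgt u hu
    · have h2 := heq t ht
      obtain ⟨β, rfl⟩ := Nat.exists_eq_succ_of_ne_zero hα
      have h3 : t * t⁻¹ = 1 := mul_inv_cancel₀ ht.ne'
      simp only [Nat.succ_eq_add_one, Nat.add_sub_cancel, Pi.sub_apply, pow_succ] at h2 ⊢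
      linear_combination t ^ β * t * h2 -
        ((β + 1 : ℕ) : ℝ) * t ^ β * (h t - momentSum n M r N t b) * h3
  obtain ⟨x, hx, hslope⟩ := exists_hasDerivAt_eq_slope g (fun _ => 0) ht hgc.continuousOn hgd
  rw [eq_comm, div_eq_zero_iff, hg0, sub_zero, sub_zero, or_iff_left ht.ne', hgt t ht] at hslope
  exact sub_eq_zero.1 ((mul_eq_zero.1 hslope).resolve_left (pow_ne_zero _ ht.ne'))

end RadialSum

/-! ### Induction along the ladder, and conversion of the integrals into moment sums. -/

section Formulas

variable {c s : ℕ → ℕ → ℕ → ℝ} {f : E3 → ℝ}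

lemma continuous_lapMean (hf : ContDiff ℝ ∞ f) (p q : ℝ) (j : ℕ) :
    Continuous (lapMean f j p q) := (contDiff_lapMean hf j p q).continuous

lemma c_ne_zero_bound {k i m : ℕ} (h : IsCoeffFamily c s) (hne : c k i m ≠ 0) :
    i ≤ k ∧ 1 ≤ m ∧ m ≤ k + i := by
  by_contra hcon
  exact hne (h.c_zero k i m hcon)

lemma s_ne_zero_bound {k i m : ℕ} (h : IsCoeffFamily c s) (hne : s k i m ≠ 0) :
    1 ≤ i ∧ i ≤ k ∧ 1 ≤ m ∧ m < k + i := by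
  by_contra hcon
  exact hne (h.s_zero k i m hcon)

/-- Outside the index range every term is zero. Valid for all indices, the relation is an identity
of arrays to which the linear map `momentSum` can be applied. -/
lemma IsCoeffFamily.c_relation' (h : IsCoeffFamily c s) (k i m : ℕ) :
    s (k + 1) i m = 2 * ((2 * i - 1 - 2 * m - 2 * k) * (c k i m / (4 * k + 1)) -
      2 * (k + i + 1 - m) * (c (k + 1) i m / (4 * k + 5))) := by
  by_cases hr : i ≤ k + 1 ∧ 1 ≤ m ∧ m ≤ k + i + 1
  · exact h.c_relation hr.1 hr.2.1 hr.2.2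
  · rw [h.s_zero _ _ _ (by omega), h.c_zero k _ _ (by omega), h.c_zero (k + 1) _ _ (by omega)]
    simp

lemma IsCoeffFamily.s_relation' (h : IsCoeffFamily c s) (k i m : ℕ) :
    2 * (k + i + 1 - m) * ((2 * k + 2) * (2 * k + 1) / (4 * k + 3) * s (k + 1) (i + 1) m) =
      (2 * i + 1 - 2 * m - 2 * k) * (2 * k * (2 * k - 1) / (4 * k - 1) * s k (i + 1) m) +
        2 * c k i m := by
  by_cases hr : i ≤ k ∧ 1 ≤ m ∧ m ≤ k + i + 1
  · exact h.s_relation hr.1 hr.2.1 hr.2.2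
  · rw [h.s_zero _ _ _ (by omega), h.c_zero k _ _ (by omega), h.s_zero k _ _ (by omega)]
    simp

lemma sum_Icc_eq_of_zero {g : ℕ → ℝ} {a M : ℕ} (hM : a ≤ M) (hg : ∀ m, a < m → g m = 0) :
    ∑ m ∈ Icc 1 M, g m = ∑ m ∈ Icc 1 a, g m := by
  refine (sum_subset (Icc_subset_Icc_right hM) fun m _ hm => hg m ?_).symm
  simp only [mem_Icc, not_and, not_le] at *
  omega

lemma IsCoeffFamily.c_sum_relation' (h : IsCoeffFamily c s) {k M : ℕ} (hM : 2 * k + 2 ≤ M)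
    (i : ℕ) :
    ∑ m ∈ Icc 1 M, (c k i m / (4 * k + 1) - c (k + 1) i m / (4 * k + 5)) =
      if i = 0 then (4 * k + 3 : ℝ) else 0 := by
  by_cases hi : i ≤ k + 1
  · rw [← h.c_sum_relation hi, ← sum_sub_distrib]
    refine sum_Icc_eq_of_zero (by omega) fun m hm => ?_
    rw [h.c_zero k _ _ (by omega), h.c_zero (k + 1) _ _ (by omega)]
    simp
  · rw [if_neg (by omega)]
    refine sum_eq_zero fun m _ => ?_
    rw [h.c_zero k _ _ (by omega), h.c_zero (k + 1) _ _ (by omega)]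
    simp

lemma IsCoeffFamily.s_sum_relation' (h : IsCoeffFamily c s) {k M : ℕ} (hM : 2 * k + 1 ≤ M)
    (i : ℕ) :
    ∑ m ∈ Icc 1 M, ((2 * k + 2) * (2 * k + 1) / (4 * k + 3) * s (k + 1) (i + 1) m -
      2 * k * (2 * k - 1) / (4 * k - 1) * s k (i + 1) m) =
      if i = 0 then (8 * k + 2 : ℝ) else 0 := by
  by_cases hi : i ≤ k
  · rw [← h.s_sum_relation hi, ← sum_sub_distrib]
    refine sum_Icc_eq_of_zero (by omega) fun m hm => ?_
    rw [h.s_zero k _ _ (by omega), h.s_zero (k + 1) _ _ (by omega)]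
    simp
  · rw [if_neg (by omega)]
    refine sum_eq_zero fun m _ => ?_
    rw [h.s_zero k _ _ (by omega), h.s_zero (k + 1) _ _ (by omega)]
    simp

/-- The formula for `a_{0(2k)}` in terms of moments of the `Δ^i Mf`. -/
def ZonalFormula (c : ℕ → ℕ → ℕ → ℝ) (k : ℕ) : Prop :=
  ∀ f : E3 → ℝ, ContDiff ℝ ∞ f → ∀ p q t : ℝ, 0 < t → ∀ n M : ℕ, k + 1 ≤ n → 2 * k ≤ M →
    zonalCoeff f (2 * k) p q t = (4 * k + 1) * lapMean f 0 p q t +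
      momentSum n M (-1) (fun j => lapMean f j p q) t (c k)

/-- The formula for `∂_p a_{1(2k-1)} + ∂_q b_{1(2k-1)}` in terms of moments of the `Δ^i Mf`. -/
def DivFormula (s : ℕ → ℕ → ℕ → ℝ) (k : ℕ) : Prop :=
  ∀ f : E3 → ℝ, ContDiff ℝ ∞ f → ∀ p q t : ℝ, 0 < t → ∀ n M : ℕ, k ≤ n → 2 * k ≤ M + 1 →
    divCoeff f (2 * k - 1) p q t =
      momentSum n M 0 (fun j => lapMean f (j + 1) p q) t (fun j => s k (j + 1))

lemma zonalFormula_zero (h : IsCoeffFamily c s) : ZonalFormula c 0 := by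
  intro f hf p q t ht n M hn hM
  have : c 0 = 0 := by ext i m; exact h.c_zero _ _ _ (by omega)
  rw [this, map_zero, zonalCoeff_eq, lapMean_eq hf, sphMean_eq]
  simp [legendre_zero]

/-- The truncated index 2·0 - 1 = 0 gives a coefficient with weight P_0' = 0, so D_1 and A_2 need no
separate computation. -/
lemma divFormula_zero (h : IsCoeffFamily c s) : DivFormula s 0 := by
  intro f hf p q t ht n M hn hM
  have : (fun j => s 0 (j + 1)) = 0 := by ext i m; exact h.s_zero _ _ _ (by omega)
  rw [this, map_zero, divCoeff]
  simp [legendre_zero, horizInt]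

lemma deriv_eq_of_eqOn_Ioi {g g' : ℝ → ℝ} {d t : ℝ} (hgg' : ∀ t, 0 < t → g t = g' t)
    (ht : 0 < t) (hd : HasDerivAt g' d t) : deriv g t = d := by
  refine (hd.congr_of_eventuallyEq ?_).deriv
  filter_upwards [lt_mem_nhds ht] with u hu using hgg' u hu

lemma divFormula_succ (h : IsCoeffFamily c s) {k : ℕ} (hA : ZonalFormula c k)
    (hB : DivFormula s k) : DivFormula s (k + 1) := by
  intro f hf p q t ht n M hn hM
  set N : ℕ → ℝ → ℝ := fun j => lapMean f (j + 1) p q with hNdef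
  have hN : ∀ j, Continuous (N j) := fun j => continuous_lapMean hf p q (j + 1)
  set w : ℝ := (2 * k + 2) * (2 * k + 1) / (4 * k + 3) with hw
  set κ : ℝ := 2 * k * (2 * k - 1) / (4 * k - 1) with hκ
  have hw0 : w ≠ 0 := by positivity
  set b : ℕ → ℕ → ℝ := w • fun j => s (k + 1) (j + 1) with hb
  set ρ : ℕ → ℕ → ℝ := κ • fun j => s k (j + 1) with hρ
  have key := eq_momentSum (n := n) (M := M) (r := 0) hN
    (h := fun t => w * divCoeff f (2 * (k + 1) - 1) p q t)
    (((contDiff_divCoeff hf _ p q).differentiable (by simp)).const_mul w)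
    (α := 2 * k + 2) (by omega) (b := b) ?_ ?_ ht
  · rw [hb, map_smul, smul_eq_mul] at key
    exact mul_left_cancel₀ hw0 key
  -- Nonzero entries have m ≤ k + j + 1, so α = 2k + 2 is just large enough to make the exponent 2j
  -- - 2m + α nonnegative.
  · intro j m hjm
    have hne : s (k + 1) (j + 1) m ≠ 0 := fun h0 => hjm (by simp [hb, h0])
    have := s_ne_zero_bound h hne
    push_cast
    omega
  · intro t ht
    have ode := zonalCoeff_hlap_eq hf k p q ht.ne'
    -- The induction hypothesis is needed for the Laplacian of f, which shifts the index of
    -- `lapMean` by one. The free bounds n, M put all the sums on a common rectangle.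
    rw [hA (hlap f) (contDiff_hlap hf) p q t ht n M hn (by omega)] at ode
    have hDk : ∀ t, 0 < t → κ * divCoeff f (2 * k - 1) p q t = momentSum n M 0 N t ρ := by
      intro t ht
      rw [hB f hf p q t ht n M (by omega) (by omega), hρ, map_smul, smul_eq_mul]
    have hDk' := deriv_eq_of_eqOn_Ioi hDk ht (hasDerivAt_momentSum hN ρ ht.ne')
    have hdif (j : ℕ) : DifferentiableAt ℝ (divCoeff f j p q) t :=
      ((contDiff_divCoeff hf j p q).differentiable (by simp)) t
    rw [deriv_const_mul _ (hdif _)] at hDk' ⊢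
    have hNl : (fun j => lapMean (hlap f) j p q) = N := by
      ext j u
      exact lapMean_hlap hf j p q u
    rw [hNl, lapMean_hlap hf, show (-1 : ℤ) = 0 - 1 by norm_num, momentSum_sub_one _ ht.ne'] at ode
    have hrel : exponentMul 0 b + (2 * k + 2 : ℝ) • b - (2 : ℝ) • c k - exponentMul 0 ρ +
        (2 * k - 1 : ℝ) • ρ = 0 := by
      ext j m
      have := h.s_relation' k j m
      simp only [Pi.add_apply, Pi.sub_apply, Pi.smul_apply, smul_eq_mul, exponentMul, hb, hρ,
        Pi.zero_apply, Int.cast_zero]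
      linear_combination this
    have hrel' := congrArg (momentSum n M 0 N t) hrel
    simp only [map_add, map_sub, map_smul, map_zero, smul_eq_mul] at hrel'
    -- The constant is 2(4k + 1), from the leading term (4k + 1) ΔMf of ΔA_{2k}.
    have hbd : boundarySum n M 0 N t b - boundarySum n M 0 N t ρ = (8 * k + 2) * N 0 t := by
      rw [← map_sub, boundarySum_apply]
      have : ∀ j, ∑ m ∈ Icc 1 M, (b - ρ) j m = if j = 0 then (8 * k + 2 : ℝ) else 0 := fun j =>
        h.s_sum_relation' (by omega) j
      simp only [this]
      rw [sum_eq_single_of_mem 0 (mem_range.2 (by omega))]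
      · simp
      · intro j _ hj
        simp [hj]
    have h1 := hDk t ht
    push_cast
    change _ = w * (_ + _ * _ * _) - κ * (_ - _ * _ * _) at ode
    change _ * ((4 * k + 1 : ℝ) * N 0 t + _) = _ at ode
    linear_combination -ode + hDk' - (2 * k - 1) * t⁻¹ * h1 - t⁻¹ * hrel' - hbd

lemma zonalFormula_succ (h : IsCoeffFamily c s) {k : ℕ} (hA : ZonalFormula c k)
    (hB : DivFormula s (k + 1)) : ZonalFormula c (k + 1) := by
  intro f hf p q t ht n M hn hM
  set N : ℕ → ℝ → ℝ := fun j => lapMean f j p q with hNdef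
  have hN : ∀ j, Continuous (N j) := fun j => continuous_lapMean hf p q j
  have hN0 : Differentiable ℝ (N 0) := (contDiff_lapMean hf 0 p q).differentiable (by simp)
  have hdif (j : ℕ) : Differentiable ℝ (zonalCoeff f j p q) :=
    (contDiff_zonalCoeff hf j p q).differentiable (by simp)
  set γ : ℕ → ℕ → ℝ := (1 / (4 * k + 1) : ℝ) • c k with hγ
  set γ' : ℕ → ℕ → ℝ := (1 / (4 * k + 5) : ℝ) • c (k + 1) with hγ'
  have h5 : (4 * k + 5 : ℝ) ≠ 0 := by positivity
  have h1 : (4 * k + 1 : ℝ) ≠ 0 := by positivity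
  -- The leading term Mf is not a moment sum, so it is subtracted before uniqueness is invoked.
  have key := eq_momentSum (n := n) (M := M) (r := -1) hN
    (h := fun t => 1 / (4 * k + 5) * zonalCoeff f (2 * (k + 1)) p q t - N 0 t)
    (((hdif _).const_mul _).sub hN0)
    (α := 2 * k + 3) (by omega) (b := γ') ?_ ?_ ht
  · rw [hγ', map_smul, smul_eq_mul] at key
    field_simp at key
    push_cast
    linear_combination key
  · intro j m hjm
    have hne : c (k + 1) j m ≠ 0 := fun h0 => hjm (by simp [hγ', h0])
    have := c_ne_zero_bound h hne
    push_cast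
    omega
  · intro t ht
    have ode := divCoeff_eq hf k p q ht.ne'
    obtain ⟨n, rfl⟩ : ∃ n', n = n' + 1 := ⟨n - 1, by omega⟩
    have hDiv := hB f hf p q t ht n M (by omega) (by omega)
    rw [show (fun j => lapMean f (j + 1) p q) = fun j => N (j + 1) from rfl,
      show (0 : ℤ) = (-1 - 1) + 2 by norm_num,
      ← momentSum_succ (fun m => h.s_zero _ _ _ (by omega)), momentSum_sub_one _ ht.ne'] at hDiv
    rw [show 2 * (k + 1) - 1 = 2 * k + 1 by omega, ode] at hDiv
    have hak : ∀ t, 0 < t → 1 / (4 * k + 1) * zonalCoeff f (2 * k) p q t =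
        N 0 t + momentSum (n + 1) M (-1) N t γ := by
      intro t ht
      rw [hA f hf p q t ht (n + 1) M (by omega) (by omega), hγ, map_smul, smul_eq_mul]
      field_simp
      rfl
    have hak' := deriv_eq_of_eqOn_Ioi hak ht
      ((hN0 t).hasDerivAt.add (hasDerivAt_momentSum hN γ ht.ne'))
    rw [deriv_const_mul _ (hdif _ t)] at hak'
    rw [deriv_fun_sub ((hdif _ t).const_mul _) (hN0 t), deriv_const_mul _ (hdif _ t)]
    have hrel : exponentMul (-1) γ - (2 * k : ℝ) • γ - (1 / 2 : ℝ) • s (k + 1) -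
        exponentMul (-1) γ' - (2 * k + 3 : ℝ) • γ' = 0 := by
      ext j m
      have := h.c_relation' k j m
      simp only [Pi.sub_apply, Pi.smul_apply, smul_eq_mul, exponentMul, hγ, hγ',
        Pi.zero_apply]
      push_cast
      linear_combination (-1 / 2) * this
    have hrel' := congrArg (momentSum (n + 1) M (-1) N t) hrel
    simp only [map_sub, map_smul, map_zero, smul_eq_mul] at hrel'
    -- After normalization both A_{2k} and A_{2k+2} have leading term Mf: its derivatives cancel,
    -- and 2k + (2k + 3) copies of t⁻¹ Mf remain.
    have hbd : boundarySum (n + 1) M (-1) N t γ - boundarySum (n + 1) M (-1) N t γ' =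
        (4 * k + 3) * (t⁻¹ * N 0 t) := by
      rw [← map_sub, boundarySum_apply]
      have : ∀ j, ∑ m ∈ Icc 1 M, (γ - γ') j m = if j = 0 then (4 * k + 3 : ℝ) else 0 := by
        intro j
        rw [← h.c_sum_relation' (show 2 * k + 2 ≤ M by omega) j]
        refine sum_congr rfl fun m _ => ?_
        simp only [Pi.sub_apply, Pi.smul_apply, smul_eq_mul, hγ, hγ']
        ring
      simp only [this]
      rw [sum_eq_single_of_mem 0 (mem_range.2 (by omega))]
      · simp
      · intro j _ hj
        simp [hj]
    have h2 := hak t ht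
    push_cast
    linear_combination (-1 / 2) * hDiv + hak' - 2 * k * t⁻¹ * h2 + t⁻¹ * hrel' + hbd

theorem zonalFormula_and_divFormula (h : IsCoeffFamily c s) (k : ℕ) :
    ZonalFormula c k ∧ DivFormula s k := by
  induction k with
  | zero => exact ⟨zonalFormula_zero h, divFormula_zero h⟩
  | succ k ih =>
    have hB := divFormula_succ h ih.1 ih.2
    exact ⟨zonalFormula_succ h ih.1 hB, hB⟩

lemma intervalIntegral_term {N : ℝ → ℝ} (t : ℝ) (a : ℝ) (m : ℕ) :
    ∫ u in (0 : ℝ)..t, a * (u / t) ^ (2 * m) * N u = a * (t⁻¹ ^ (2 * m) * moment N m t) := by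
  rw [moment, ← intervalIntegral.integral_const_mul, ← intervalIntegral.integral_const_mul]
  congr 1
  ext u
  rw [div_eq_mul_inv, mul_pow]
  ring

lemma continuous_zonalIntegrand (hf : ContDiff ℝ ∞ f) (k : ℕ) (p q t : ℝ) :
    Continuous (zonalIntegrand c f k p q t) := by
  have := continuous_lapMean hf p q
  unfold zonalIntegrand
  fun_prop

lemma continuous_divIntegrand (hf : ContDiff ℝ ∞ f) (k : ℕ) (p q t : ℝ) :
    Continuous (divIntegrand s f k p q t) := by
  have := continuous_lapMean hf p q
  unfold divIntegrand
  fun_prop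

lemma integral_zonalIntegrand (h : IsCoeffFamily c s) (hf : ContDiff ℝ ∞ f) (k : ℕ) (p q : ℝ)
    {t : ℝ} (ht : t ≠ 0) :
    ∫ u in (0 : ℝ)..t, zonalIntegrand c f k p q t u =
      momentSum (k + 1) (2 * k) (-1) (fun j => lapMean f j p q) t (c k) := by
  have hc := continuous_lapMean hf p q
  simp only [zonalIntegrand, momentSum_apply]
  rw [integral_finsetSum fun i _ => Continuous.intervalIntegrable (by fun_prop) _ _,
    show Icc 0 k = range (k + 1) by ext; simp]
  refine sum_congr rfl fun i hi => ?_
  rw [mem_range] at hi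
  rw [intervalIntegral.integral_const_mul,
    integral_finsetSum fun i _ => Continuous.intervalIntegrable (by fun_prop) _ _,
    sum_Icc_eq_of_zero (M := 2 * k) (a := k + i)
      (g := fun m => c k i m * (t ^ (2 * i + -1 - 2 * m : ℤ) * moment (lapMean f i p q) m t))
      (by omega)
      fun m hm => by rw [h.c_zero k i m (by omega), zero_mul], mul_sum]
  refine sum_congr rfl fun m _ => ?_
  rw [intervalIntegral_term, show (2 * i + -1 - 2 * m : ℤ) = (2 * i - 1) + -((2 * m : ℕ) : ℤ) by
    push_cast; ring, zpow_add₀ ht, zpow_neg, zpow_natCast, inv_pow]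
  ring

lemma integral_divIntegrand (h : IsCoeffFamily c s) (hf : ContDiff ℝ ∞ f) (k : ℕ) (p q : ℝ)
    {t : ℝ} (ht : t ≠ 0) :
    ∫ u in (0 : ℝ)..t, divIntegrand s f k p q t u =
      momentSum k (2 * k) 0 (fun j => lapMean f (j + 1) p q) t (fun j => s k (j + 1)) := by
  have hc := continuous_lapMean hf p q
  simp only [divIntegrand, momentSum_apply]
  rw [integral_finsetSum fun i _ => Continuous.intervalIntegrable (by fun_prop) _ _,
    show Icc 1 k = Ico 1 (k + 1) by ext; simp, sum_Ico_eq_sum_range,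
    Nat.add_sub_cancel]
  simp only [Nat.add_comm 1]
  refine sum_congr rfl fun i hi => ?_
  rw [mem_range] at hi
  rw [intervalIntegral.integral_const_mul,
    integral_finsetSum fun i _ => Continuous.intervalIntegrable (by fun_prop) _ _,
    sum_Icc_eq_of_zero (M := 2 * k) (a := k + (i + 1) - 1)
      (g := fun m => s k (i + 1) m *
        (t ^ (2 * i + 0 - 2 * m : ℤ) * moment (lapMean f (i + 1) p q) m t)) (by omega)
      fun m hm => by rw [h.s_zero k (i + 1) m (by omega), zero_mul], mul_sum]
  refine sum_congr rfl fun m _ => ?_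
  rw [intervalIntegral_term, show (2 * i + 0 - 2 * m : ℤ) = (2 * i : ℕ) + -((2 * m : ℕ) : ℤ) by
    push_cast; ring, zpow_add₀ ht, zpow_neg, zpow_natCast, zpow_natCast, inv_pow,
    Nat.add_sub_cancel]
  ring

end Formulas

end SphericalCoeffs

end

theorem theorem4 :
    (∃! cs : (ℕ → ℕ → ℕ → ℝ) × (ℕ → ℕ → ℕ → ℝ),
      SphericalCoeffs.IsCoeffFamily cs.1 cs.2) ∧
    ∀ c s : ℕ → ℕ → ℕ → ℝ, SphericalCoeffs.IsCoeffFamily c s →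
    ∀ f : SphericalCoeffs.E3 → ℝ, ContDiff ℝ (⊤ : ℕ∞) f →
      (∀ u : ℝ, ContDiff ℝ (⊤ : ℕ∞) fun P : ℝ × ℝ => SphericalCoeffs.sphMean f P.1 P.2 u) ∧
      ∀ k : ℕ, 0 < k → ∀ p q t : ℝ, 0 < t →
        (IntervalIntegrable (SphericalCoeffs.zonalIntegrand c f k p q t)
            MeasureTheory.volume 0 t ∧
          SphericalCoeffs.zonalCoeff f (2 * k) p q t =
            (4 * k + 1) * SphericalCoeffs.sphMean f p q t +
              ∫ u in (0 : ℝ)..t, SphericalCoeffs.zonalIntegrand c f k p q t u) ∧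
        (DifferentiableAt ℝ (fun x => SphericalCoeffs.cosCoeff f 1 (2 * k - 1) x q t) p ∧
          DifferentiableAt ℝ (fun y => SphericalCoeffs.sinCoeff f 1 (2 * k - 1) p y t) q ∧
          IntervalIntegrable (SphericalCoeffs.divIntegrand s f k p q t)
            MeasureTheory.volume 0 t ∧
          deriv (fun x => SphericalCoeffs.cosCoeff f 1 (2 * k - 1) x q t) p +
              deriv (fun y => SphericalCoeffs.sinCoeff f 1 (2 * k - 1) p y t) q =
            ∫ u in (0 : ℝ)..t, SphericalCoeffs.divIntegrand s f k p q t u) := by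
  refine ⟨SphericalCoeffs.existsUnique_isCoeffFamily, fun c s h f hf =>
    ⟨SphericalCoeffs.contDiff_sphMean_centre hf, fun k _ p q t ht => ?_⟩⟩
  obtain ⟨hA, hB⟩ := SphericalCoeffs.zonalFormula_and_divFormula h k
  refine ⟨⟨(SphericalCoeffs.continuous_zonalIntegrand hf k p q t).intervalIntegrable _ _, ?_⟩,
    (SphericalCoeffs.hasDerivAt_cosCoeff hf _ p q t).differentiableAt,
    (SphericalCoeffs.hasDerivAt_sinCoeff hf _ p q t).differentiableAt,
    (SphericalCoeffs.continuous_divIntegrand hf k p q t).intervalIntegrable _ _, ?_⟩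
  · rw [SphericalCoeffs.integral_zonalIntegrand h hf k p q ht.ne']
    exact hA f hf p q t ht _ _ le_rfl le_rfl
  · rw [SphericalCoeffs.deriv_cosCoeff_add_deriv_sinCoeff hf,
      SphericalCoeffs.integral_divIntegrand h hf k p q ht.ne']
    exact hB f hf p q t ht _ _ le_rfl (by omega)
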